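/- **Setting.** Let $M$ be a smooth manifold with a Borel measure $m$ (e.g. Riemannian volume), $f:M\to M$ a measurable map that is non-singular with respect to $m$ (i.e. $m(f^{-1}A)=0$ whenever $m(A)=0$), and $Y\subset M$ a measurable set with $m(Y)=1$ such that $m$-a.e. point of $Y$ returns to $Y$. Let $\varphi:Y\to\mathbb N$ be the first return time, $F=f^{\varphi}:Y\to Y$ the first return map, $Y_n=\{\varphi=n\}$, and let $R:L^1(Y,m)\to L^1(Y,m)$ be the transfer operator of $F$, $\int_Y Rv\,w\,dm=\int_Y v\,w\circ F\,dm$ for bounded measurable $w$. Let $\alpha,\gamma>0$ and let $\mathcal B,\mathcal B_w$ be complex Banach spaces of distributions supported on $Y$, that is, there are continuous linear maps $C^\alpha(M,\mathbb C)\to\mathcal B\to\mathcal B_w\to (C^\gamma(M,\mathbb C))'$, the last two injective, whose composition sends $g$ to $\phi\mapsto\int_Y g\phi\,dm$. An element of $\mathcal B$ or $\mathcal B_w$ is called a function $g\in L^1(Y,m)$ (resp. a finite complex measure $\nu$) if it acts on $C^\gamma$ by $\phi\mapsto\int_Y g\phi\,dm$ (resp. $\phi\mapsto\int\phi\,d\nu$);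 on such elements, multiplication by a $C^\alpha$ function or by an indicator function has its usual meaning. Assume: * (H1) For some $C>0$, multiplication by any $\phi\in C^\alpha$ acts on $\mathcal B$ with $\|h\phi\|_{\mathcal B}\le C\|h\|_{\mathcal B}\|\phi\|_{C^\alpha}$. The transfer operator $R$ on $\mathcal B\cap L^1(Y,m)$ extends to a bounded operator $R:\mathcal B\to\mathcal B$. The number $1$ is an (algebraically) simple eigenvalue of $R:\mathcal B\to\mathcal B$, and the rest of the spectrum is contained in a disk about $0$ of radius less than $1$. The fixed vector $\mu\in\mathcal B$ of $R$ with $\langle\mu,1\rangle=1$ is a probability measure. * (H2) with $\varpi=1$: there is $C>0$ such that for all $n\ge1$ and $h\in\mathcal B$, $1_{Y_n}h\in\mathcal B_w$ and $|\langle 1_{Y_n}h,1\rangle|\le C\|h\|_{\mathcal B}\,\mu(Y_n)$. * (H3) $\mu(\varphi>n)=\ell(n)n^{-\beta}$ for all $n\ge1$, where $\ell$ is (measurable, eventually positive and) slowly varying at infinity and $\beta\in(0,1)$. * (H4)(i) For each $n\geq 1$, the operator $v\mapsto R(1_{Y_n}v)$ on $\mathcal B\cap L^1(Y,m)$ extends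 to a bounded operator $R_n:\mathcal B\to\mathcal B$, and $\sum_{n\ge1}\|R_n\|_{\mathcal B\to\mathcal B}<\infty$. For $|z|\le1$ put $R(z)=\sum_{n\ge1}z^nR_n$; these extensions are such that $R(1)=R$. * (H5)(i) There are $C>0$ and $\rho>1$ such that for all $|z|\le1$, $h\in\mathcal B$ and $n\ge0$, $$\|R(z)^nh\|_{\mathcal B_w}\le C|z|^n\|h\|_{\mathcal B_w},\qquad \|R(z)^nh\|_{\mathcal B}\le C\rho^{-n}|z|^n\|h\|_{\mathcal B}+C|z|^n\|h\|_{\mathcal B_w}.$$ **Conclusion.** There is $\delta>0$ such that for every $z$ with $|z|\le1$ and $|z-1|<\delta$ the operator $R(z):\mathcal B\to\mathcal B$ has a leading eigenvalue $\lambda(z)$, i.e. an (algebraically) simple eigenvalue such that the rest of the spectrum of $R(z)$ is contained in a disk about $0$ of radius less than $|\lambda(z)|$. Moreover, as $(u,\theta)\to(0,0)$ with $u\ge0$, $\theta\in\mathbb R$ and $(u,\theta)\ne(0,0)$, $$1-\lambda(e^{-(u-i\theta)})=\Gamma(1-\beta)\,\ell(1/|u-i\theta|)\,(u-i\theta)^\beta\,(1+o(1)),$$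 with the principal branch of the power. -/

import Mathlib

open Set Filter Topology MeasureTheory
open scoped Manifold ContDiff ENNReal

noncomputable section

/-! ### Hölder spaces `C^α` on a manifold -/

section Holder

variable {E : Type*} [NormedAddCommGroup E] [NormedSpace ℝ E]

/-- The (extended) `C^{k,r}` norm of `u` on `s ⊆ E`: the sup norms of the derivatives of order at
most `k`, plus the `r`-Hölder seminorm of the derivative of order `k`. -/
def holderENormOn (k : ℕ) (r : ℝ) (s : Set E) (u : E → ℂ) : ℝ≥0∞ :=
  (∑ j ∈ Finset.range (k + 1), ⨆ x ∈ s, ‖iteratedFDerivWithin ℝ j u s x‖ₑ) +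
    ⨆ x ∈ s, ⨆ y ∈ s,
      ‖iteratedFDerivWithin ℝ k u s x - iteratedFDerivWithin ℝ k u s y‖ₑ / edist x y ^ r

theorem enorm_add_le_of_norm {F : Type*} [NormedAddCommGroup F] (a b : F) :
    ‖a + b‖ₑ ≤ ‖a‖ₑ + ‖b‖ₑ := enorm_add_le a b

theorem enorm_zero_of_norm {F : Type*} [NormedAddCommGroup F] : ‖(0 : F)‖ₑ = 0 := enorm_zero

theorem holderENormOn_add {k : ℕ} {r : ℝ} {s : Set E} (hs : UniqueDiffOn ℝ s) {u v : E → ℂ}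
    (hu : ContDiffOn ℝ k u s) (hv : ContDiffOn ℝ k v s) :
    holderENormOn k r s (u + v) ≤ holderENormOn k r s u + holderENormOn k r s v := by
  have key : ∀ j ≤ k, ∀ x ∈ s, iteratedFDerivWithin ℝ j (u + v) s x
      = iteratedFDerivWithin ℝ j u s x + iteratedFDerivWithin ℝ j v s x := fun j hj x hx =>
    iteratedFDerivWithin_add_apply ((hu x hx).of_le (by exact_mod_cast hj))
      ((hv x hx).of_le (by exact_mod_cast hj)) hs hx
  unfold holderENormOn
  rw [add_add_add_comm, ← Finset.sum_add_distrib]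
  refine add_le_add (Finset.sum_le_sum fun j hj => ?_) ?_
  · refine iSup₂_le fun x hx => ?_
    rw [key j (by simpa [Nat.lt_succ_iff] using hj) x hx]
    refine (enorm_add_le_of_norm _ _).trans (add_le_add ?_ ?_)
    · exact le_iSup₂ (f := fun x (_ : x ∈ s) => ‖iteratedFDerivWithin ℝ j u s x‖ₑ) x hx
    · exact le_iSup₂ (f := fun x (_ : x ∈ s) => ‖iteratedFDerivWithin ℝ j v s x‖ₑ) x hx
  · refine iSup₂_le fun x hx => iSup₂_le fun y hy => ?_
    rw [key k le_rfl x hx, key k le_rfl y hy, add_sub_add_comm]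
    refine (ENNReal.div_le_div_right (enorm_add_le_of_norm _ _) _).trans ?_
    rw [ENNReal.add_div]
    refine add_le_add ?_ ?_
    · exact le_iSup₂_of_le x hx (le_iSup₂_of_le y hy le_rfl)
    · exact le_iSup₂_of_le x hx (le_iSup₂_of_le y hy le_rfl)

theorem holderENormOn_smul {k : ℕ} {r : ℝ} {s : Set E} (hs : UniqueDiffOn ℝ s) {u : E → ℂ}
    (hu : ContDiffOn ℝ k u s) (a : ℂ) :
    holderENormOn k r s (a • u) = ‖a‖ₑ * holderENormOn k r s u := by
  have key : ∀ j ≤ k, ∀ x ∈ s, iteratedFDerivWithin ℝ j (a • u) s x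
      = a • iteratedFDerivWithin ℝ j u s x := fun j hj x hx =>
    iteratedFDerivWithin_const_smul_apply ((hu x hx).of_le (by exact_mod_cast hj)) hs hx
  unfold holderENormOn
  rw [mul_add, Finset.mul_sum]
  congr 1
  · refine Finset.sum_congr rfl fun j hj => ?_
    simp only [ENNReal.mul_iSup]
    refine iSup_congr fun x => iSup_congr fun hx => ?_
    rw [key j (by simpa [Nat.lt_succ_iff] using hj) x hx, enorm_smul]
  · simp only [ENNReal.mul_iSup]
    refine iSup_congr fun x => iSup_congr fun hx => iSup_congr fun y => iSup_congr fun hy => ?_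
    rw [key k le_rfl x hx, key k le_rfl y hy, ← smul_sub, enorm_smul, mul_div_assoc]

theorem holderENormOn_const_le (k : ℕ) (r : ℝ) (s : Set E) (a : ℂ) :
    holderENormOn k r s (fun _ => a) ≤ (k + 1) * ‖a‖ₑ := by
  have key : ∀ j, ∀ x, ‖iteratedFDerivWithin ℝ j (fun _ : E => a) s x‖ₑ ≤ ‖a‖ₑ := by
    intro j x
    rcases eq_or_ne j 0 with rfl | hj
    · rw [enorm_le_iff_norm_le, norm_iteratedFDerivWithin_zero]
    · rw [iteratedFDerivWithin_const_of_ne hj, Pi.zero_apply, enorm_zero_of_norm]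
      exact zero_le
  have key' : ∀ x y, iteratedFDerivWithin ℝ k (fun _ : E => a) s x
      = iteratedFDerivWithin ℝ k (fun _ : E => a) s y := by
    intro x y
    rcases eq_or_ne k 0 with rfl | hk
    · ext m; simp
    · rw [iteratedFDerivWithin_const_of_ne hk]; rfl
  unfold holderENormOn
  have h2 : (⨆ x ∈ s, ⨆ y ∈ s, ‖iteratedFDerivWithin ℝ k (fun _ : E => a) s x
      - iteratedFDerivWithin ℝ k (fun _ : E => a) s y‖ₑ / edist x y ^ r) = 0 := by
    simp only [ENNReal.iSup_eq_zero]
    intro x _ y _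
    rw [key' x y, sub_self, enorm_zero_of_norm, ENNReal.zero_div]
  rw [h2, add_zero]
  refine (Finset.sum_le_card_nsmul _ _ ‖a‖ₑ fun j _ => iSup₂_le fun x _ => key j x).trans ?_
  simp

theorem enorm_le_holderENormOn (k : ℕ) (r : ℝ) (s : Set E) (u : E → ℂ) {x : E} (hx : x ∈ s) :
    ‖u x‖ₑ ≤ holderENormOn k r s u := by
  unfold holderENormOn
  refine le_add_right ?_
  have h0 : ‖u x‖ₑ ≤ ⨆ x ∈ s, ‖iteratedFDerivWithin ℝ 0 u s x‖ₑ := by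
    refine le_iSup₂_of_le x hx ?_
    rw [enorm_le_iff_norm_le, norm_iteratedFDerivWithin_zero]
  exact h0.trans (Finset.single_le_sum
    (f := fun j => ⨆ x ∈ s, ‖iteratedFDerivWithin ℝ j u s x‖ₑ) (fun _ _ => zero_le)
    (Finset.mem_range.2 k.succ_pos))

variable {H : Type*} [TopologicalSpace H]

/-- A family of smooth charts covering `M`, with respect to which `C^α` norms are computed
(on a compact manifold: a finite family of relatively compact charts). -/
structure ChartCover (I : ModelWithCorners ℝ E H) (M : Type*) [TopologicalSpace M]
    [ChartedSpace H M] (ι : Type*) where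
  /-- the charts -/
  chart : ι → OpenPartialHomeomorph M H
  chart_mem : ∀ i, chart i ∈ IsManifold.maximalAtlas I ∞ M
  cover : ∀ x : M, ∃ i, x ∈ (chart i).source

variable {I : ModelWithCorners ℝ E H} {M : Type*} [TopologicalSpace M] [ChartedSpace H M]
  {ι : Type*}

namespace ChartCover

/-- The image of the `i`-th chart in the model vector space. -/
def domain (c : ChartCover I M ι) (i : ι) : Set E := ((c.chart i).extend I).target

/-- The function `φ` read in the `i`-th chart. -/
def read (c : ChartCover I M ι) (i : ι) (φ : M → ℂ) : E → ℂ := φ ∘ ((c.chart i).extend I).symm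

theorem uniqueDiffOn_domain (c : ChartCover I M ι) (i : ι) : UniqueDiffOn ℝ (c.domain i) := by
  rw [domain, OpenPartialHomeomorph.extend_target]
  exact I.uniqueDiffOn_preimage (c.chart i).open_target

/-- The (extended) `C^α` norm on `M`, `α = k + r` with `k = ⌊α⌋` and `r ∈ [0, 1)`. -/
def holderENorm (c : ChartCover I M ι) (α : ℝ) (φ : M → ℂ) : ℝ≥0∞ :=
  ⨆ i, holderENormOn ⌊α⌋₊ (α - ⌊α⌋₊) (c.domain i) (c.read i φ)

/-- The vector space `C^α(M, ℂ)`. -/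
def holderSubmodule (c : ChartCover I M ι) (α : ℝ) : Submodule ℂ (M → ℂ) where
  carrier := {φ | (∀ i, ContDiffOn ℝ ⌊α⌋₊ (c.read i φ) (c.domain i)) ∧ c.holderENorm α φ < ⊤}
  add_mem' := by
    rintro φ ψ ⟨h1, h2⟩ ⟨h3, h4⟩
    refine ⟨fun i => (h1 i).add (h3 i), lt_of_le_of_lt (iSup_le fun i => ?_)
      (ENNReal.add_lt_top.2 ⟨h2, h4⟩)⟩
    refine (holderENormOn_add (c.uniqueDiffOn_domain i) (h1 i) (h3 i)).trans (add_le_add ?_ ?_)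
    · exact le_iSup (fun i => holderENormOn ⌊α⌋₊ (α - ⌊α⌋₊) (c.domain i) (c.read i φ)) i
    · exact le_iSup (fun i => holderENormOn ⌊α⌋₊ (α - ⌊α⌋₊) (c.domain i) (c.read i ψ)) i
  zero_mem' := by
    refine ⟨fun i => contDiffOn_const, lt_of_le_of_lt (iSup_le fun i => ?_) ENNReal.zero_lt_top⟩
    exact (holderENormOn_const_le ⌊α⌋₊ (α - ⌊α⌋₊) (c.domain i) 0).trans (by simp)
  smul_mem' := by
    rintro a φ ⟨h1, h2⟩
    refine ⟨fun i => (h1 i).const_smul a, lt_of_le_of_lt (iSup_le fun i => ?_)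
      (ENNReal.mul_lt_top (enorm_lt_top (x := a)) h2)⟩
    exact (holderENormOn_smul (c.uniqueDiffOn_domain i) (h1 i) a).le.trans
      (mul_le_mul_right (le_iSup
        (fun i => holderENormOn ⌊α⌋₊ (α - ⌊α⌋₊) (c.domain i) (c.read i φ)) i) _)

end ChartCover

/-- The space `C^α(M, ℂ)` with its norm. -/
def HolderSpace (c : ChartCover I M ι) (α : ℝ) : Type _ := c.holderSubmodule α

namespace HolderSpace

variable {c : ChartCover I M ι} {α : ℝ}

instance : AddCommGroup (HolderSpace c α) := inferInstanceAs (AddCommGroup (c.holderSubmodule α))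

instance : Module ℂ (HolderSpace c α) := inferInstanceAs (Module ℂ (c.holderSubmodule α))

instance : CoeFun (HolderSpace c α) (fun _ => M → ℂ) := ⟨fun φ => φ.1⟩

instance : Norm (HolderSpace c α) := ⟨fun φ => (c.holderENorm α φ).toReal⟩

theorem core : NormedSpace.Core ℂ (HolderSpace c α) where
  norm_nonneg _ := ENNReal.toReal_nonneg
  norm_smul a φ := by
    change (c.holderENorm α (a • φ.1)).toReal = ‖a‖ * (c.holderENorm α φ.1).toReal
    have h : c.holderENorm α (a • φ.1) = ‖a‖ₑ * c.holderENorm α φ.1 := by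
      unfold ChartCover.holderENorm
      rw [ENNReal.mul_iSup]
      exact iSup_congr fun i => holderENormOn_smul (c.uniqueDiffOn_domain i) (φ.2.1 i) a
    rw [h, ENNReal.toReal_mul, toReal_enorm]
  norm_triangle φ ψ := by
    change (c.holderENorm α (φ.1 + ψ.1)).toReal ≤ _
    rw [show ‖φ‖ + ‖ψ‖ = (c.holderENorm α φ.1 + c.holderENorm α ψ.1).toReal from
      (ENNReal.toReal_add φ.2.2.ne ψ.2.2.ne).symm]
    refine ENNReal.toReal_mono (ENNReal.add_lt_top.2 ⟨φ.2.2, ψ.2.2⟩).ne (iSup_le fun i => ?_)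
    refine (holderENormOn_add (c.uniqueDiffOn_domain i) (φ.2.1 i) (ψ.2.1 i)).trans
      (add_le_add ?_ ?_)
    · exact le_iSup (fun i => holderENormOn ⌊α⌋₊ (α - ⌊α⌋₊) (c.domain i) (c.read i φ.1)) i
    · exact le_iSup (fun i => holderENormOn ⌊α⌋₊ (α - ⌊α⌋₊) (c.domain i) (c.read i ψ.1)) i
  norm_eq_zero_iff φ := by
    constructor
    · intro h
      have h0 : c.holderENorm α φ.1 = 0 := by
        rcases (ENNReal.toReal_eq_zero_iff _).1 h with h | h
        · exact h
        · exact absurd h φ.2.2.ne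
      refine Subtype.ext (funext fun x => ?_)
      obtain ⟨i, hi⟩ := c.cover x
      have hx : (c.chart i).extend I x ∈ c.domain i :=
        ((c.chart i).extend I).map_source (by simpa using hi)
      have h1 : ‖c.read i φ.1 ((c.chart i).extend I x)‖ₑ ≤ c.holderENorm α φ.1 :=
        (enorm_le_holderENormOn _ _ _ _ hx).trans (le_iSup
          (fun i => holderENormOn ⌊α⌋₊ (α - ⌊α⌋₊) (c.domain i) (c.read i φ.1)) i)
      rw [h0, nonpos_iff_eq_zero, enorm_eq_zero] at h1
      have h2 : c.read i φ.1 ((c.chart i).extend I x) = φ.1 x := by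
        rw [ChartCover.read, Function.comp_apply, (c.chart i).extend_left_inv hi]
      rw [← h2, h1]; rfl
    · rintro rfl
      have h : c.holderENorm α (0 : M → ℂ) = 0 := by
        refine le_antisymm (iSup_le fun i => ?_) zero_le
        exact (holderENormOn_const_le ⌊α⌋₊ (α - ⌊α⌋₊) (c.domain i) 0).trans (by simp)
      change (c.holderENorm α (0 : M → ℂ)).toReal = 0
      simp [h]

instance : NormedAddCommGroup (HolderSpace c α) := NormedAddCommGroup.ofCore core

instance : NormedSpace ℂ (HolderSpace c α) := NormedSpace.ofCore core

/-- The constant function `1`. -/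
instance : One (HolderSpace c α) :=
  ⟨⟨fun _ => 1, fun _ => contDiffOn_const, lt_of_le_of_lt
    (iSup_le fun i => holderENormOn_const_le ⌊α⌋₊ (α - ⌊α⌋₊) (c.domain i) 1)
    (ENNReal.mul_lt_top (by exact_mod_cast ENNReal.natCast_lt_top (⌊α⌋₊ + 1)) enorm_lt_top)⟩⟩

end HolderSpace

end Holder

/-! ### First return maps and transfer operators -/

/-- The first return time to `Y`: the least `n ≥ 1` with `f^n x ∈ Y`
(with the value `0` if there is none). -/
def returnTime {M : Type*} (f : M → M) (Y : Set M) (x : M) : ℕ := sInf {n | 1 ≤ n ∧ f^[n] x ∈ Y}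

/-- The first return map to `Y`. -/
def returnMap {M : Type*} (f : M → M) (Y : Set M) (x : M) : M := f^[returnTime f Y x] x

/-- The set `Y_n` of the points of `Y` whose first return time is `n`. -/
def returnLevel {M : Type*} (f : M → M) (Y : Set M) (n : ℕ) : Set M :=
  {x ∈ Y | returnTime f Y x = n}

/-- `g' = R g` for the transfer operator `R : L¹(ν) → L¹(ν)` of `F`, defined by duality:
`∫ (R g) w dν = ∫ g (w ∘ F) dν` for all bounded measurable `w`. -/
def IsTransferOf {M : Type*} [MeasurableSpace M] (ν : Measure M) (F : M → M) (g g' : M → ℂ) :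
    Prop :=
  Integrable g' ν ∧ ∀ w : M → ℂ, Measurable w → (∃ K : ℝ, ∀ x, ‖w x‖ ≤ K) →
    ∫ x, g' x * w x ∂ν = ∫ x, g x * w (F x) ∂ν

/-! ### Slow variation -/

/-- `ℓ` is slowly varying at infinity. -/
def IsSlowlyVarying (ℓ : ℝ → ℝ) : Prop :=
  Measurable ℓ ∧ (∀ᶠ x in atTop, 0 < ℓ x) ∧
    ∀ a : ℝ, 0 < a → Tendsto (fun x => ℓ (a * x) / ℓ x) atTop (𝓝 1)

/-! ### Leading eigenvalues -/

/-- `lam` is an (algebraically) simple eigenvalue of the bounded operator `A`: the kernel of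
`A - lam` is a line, and the range of `A - lam` is a complement of it. -/
def IsSimpleEigenvalue {B : Type*} [NormedAddCommGroup B] [NormedSpace ℂ B] (A : B →L[ℂ] B)
    (lam : ℂ) : Prop :=
  Module.finrank ℂ (LinearMap.ker ((A - lam • ContinuousLinearMap.id ℂ B : B →L[ℂ] B) :
      B →ₗ[ℂ] B)) = 1 ∧
    IsCompl (LinearMap.ker ((A - lam • ContinuousLinearMap.id ℂ B : B →L[ℂ] B) : B →ₗ[ℂ] B))
      (LinearMap.range ((A - lam • ContinuousLinearMap.id ℂ B : B →L[ℂ] B) : B →ₗ[ℂ] B))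

/-- `lam` is the leading eigenvalue of `A`: it is simple, and the rest of the spectrum lies in a
disk about `0` of radius less than `‖lam‖`. At most one number `lam` has this property. -/
def IsLeadingEigenvalue {B : Type*} [NormedAddCommGroup B] [NormedSpace ℂ B] (A : B →L[ℂ] B)
    (lam : ℂ) : Prop :=
  IsSimpleEigenvalue A lam ∧ ∃ r < ‖lam‖, ∀ w ∈ spectrum ℂ A, w ≠ lam → ‖w‖ ≤ r

/-- `R(z) = ∑_{n ≥ 1} z^n R_n`. -/
def perturbedOperator {B : Type*} [NormedAddCommGroup B] [NormedSpace ℂ B]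
    (Rn : ℕ → B →L[ℂ] B) (z : ℂ) : B →L[ℂ] B :=
  ∑' n : ℕ, z ^ (n + 1) • Rn (n + 1)

/-! ### Banach spaces of distributions -/

section Distributions

variable {E : Type*} [NormedAddCommGroup E] [NormedSpace ℝ E] {H : Type*} [TopologicalSpace H]
  {I : ModelWithCorners ℝ E H} {M : Type*} [TopologicalSpace M] [ChartedSpace H M]
  [MeasurableSpace M] {ι : Type*}

/-- Two Banach spaces `B`, `Bw` of distributions supported on `Y`, with continuous inclusions
`C^α → B → Bw → (C^γ)'` whose composition is the usual embedding `g ↦ (φ ↦ ∫_Y g φ dm)`.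
(The first map factors through the restriction to `Y`, so it is not asked to be injective.) -/
structure DistributionSpaces (c : ChartCover I M ι) (α γ : ℝ) (m : Measure M) (Y : Set M)
    (B Bw : Type*) [NormedAddCommGroup B] [NormedSpace ℂ B] [NormedAddCommGroup Bw]
    [NormedSpace ℂ Bw] where
  /-- the inclusion of `C^α` into `B` -/
  incl : HolderSpace c α →L[ℂ] B
  /-- the inclusion of `B` into `Bw` -/
  toWeak : B →L[ℂ] Bw
  /-- the inclusion of `Bw` into the dual of `C^γ` -/
  toDual : Bw →L[ℂ] StrongDual ℂ (HolderSpace c γ)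
  toWeak_injective : Function.Injective toWeak
  toDual_injective : Function.Injective toDual
  toDual_incl : ∀ (g : HolderSpace c α) (φ : HolderSpace c γ),
    toDual (toWeak (incl g)) φ = ∫ x in Y, g x * φ x ∂m
  supported : ∀ (h : Bw) (φ : HolderSpace c γ), Disjoint (tsupport (φ : M → ℂ)) (closure Y) →
    toDual h φ = 0

namespace DistributionSpaces

variable {c : ChartCover I M ι} {α γ : ℝ} {m : Measure M} {Y : Set M}
  {B Bw : Type*} [NormedAddCommGroup B] [NormedSpace ℂ B] [NormedAddCommGroup Bw]
  [NormedSpace ℂ Bw]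

/-- The distribution `h` is the complex measure `g ν`. (If `ν = m|_Y`, then `h` is the function
`g`; every finite complex measure has the form `g ν` with `ν` finite and `g ∈ L¹(ν)`.) -/
def Represents (S : DistributionSpaces c α γ m Y B Bw) (ν : Measure M) (g : M → ℂ) (h : Bw) :
    Prop :=
  Integrable g ν ∧ ∀ φ : HolderSpace c γ, S.toDual h φ = ∫ x, g x * φ x ∂ν

/-- `B` is stable under multiplication by functions in `C^α`: for some `C > 0`, one has
`h φ ∈ B` and `‖h φ‖ ≤ C ‖h‖ ‖φ‖`. -/
def HolderMultipliers (S : DistributionSpaces c α γ m Y B Bw) : Prop :=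
  ∃ C : ℝ, 0 < C ∧ ∀ φ : HolderSpace c α, ∃ T : B →L[ℂ] B, (∀ h, ‖T h‖ ≤ C * ‖h‖ * ‖φ‖) ∧
    ∀ (h : B) (ν : Measure M) [IsFiniteMeasure ν] (g : M → ℂ), S.Represents ν g (S.toWeak h) →
      S.Represents ν (fun x => g x * φ x) (S.toWeak (T h))

/-- `J : B → Bw` is the multiplication by the indicator function of `A`. -/
def IsIndicatorMul (S : DistributionSpaces c α γ m Y B Bw) (A : Set M) (J : B →ₗ[ℂ] Bw) : Prop :=
  ∀ (h : B) (ν : Measure M) [IsFiniteMeasure ν] (g : M → ℂ), S.Represents ν g (S.toWeak h) →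
    S.Represents (ν.restrict A) g (J h)

/-- `T : B → B` is a continuous extension of the operator `g ↦ R (1_A g)`, where `R` is the
transfer operator on `L¹(Y, m)` of the first return map to `Y`. -/
def ExtendsTransfer (S : DistributionSpaces c α γ m Y B Bw) (f : M → M) (A : Set M)
    (T : B →L[ℂ] B) : Prop :=
  ∀ (h : B) (g : M → ℂ), S.Represents (m.restrict Y) g (S.toWeak h) →
    ∃ g' : M → ℂ, IsTransferOf (m.restrict Y) (returnMap f Y) (A.indicator g) g' ∧
      S.Represents (m.restrict Y) g' (S.toWeak (T h))

/-- The bound `|⟨1_{Y_n} h, 1⟩| ≤ C ‖h‖ μ(Y_n)`, with `1_{Y_n} h ∈ Bw` for `h ∈ B`. -/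
def ReturnLevelBound (S : DistributionSpaces c α γ m Y B Bw) (f : M → M) (μ : Measure M) :
    Prop :=
  ∃ C : ℝ, 0 < C ∧ ∀ n : ℕ, 1 ≤ n → ∃ J : B →ₗ[ℂ] Bw,
    S.IsIndicatorMul (returnLevel f Y n) J ∧
      ∀ h : B, ‖S.toDual (J h) 1‖ ≤ C * ‖h‖ * μ.real (returnLevel f Y n)

/-- Uniform Lasota–Yorke (Doeblin–Fortet) inequalities for `R(z)`, `z` in the closed unit disk. -/
def LasotaYorke (S : DistributionSpaces c α γ m Y B Bw) (Rn : ℕ → B →L[ℂ] B) : Prop :=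
  ∃ C ρ : ℝ, 0 < C ∧ 1 < ρ ∧ ∀ z : ℂ, ‖z‖ ≤ 1 → ∀ (h : B) (n : ℕ),
    ‖S.toWeak ((perturbedOperator Rn z ^ n) h)‖ ≤ C * ‖z‖ ^ n * ‖S.toWeak h‖ ∧
    ‖(perturbedOperator Rn z ^ n) h‖ ≤
      C * (ρ ^ n)⁻¹ * ‖z‖ ^ n * ‖h‖ + C * ‖z‖ ^ n * ‖S.toWeak h‖

end DistributionSpaces

end Distributions

end

/-! Put s = u - iθ, z = e^{-s}, q_n = μ(Y_n), and let h₀ be the fixed vector of R that represents μ.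
Since ∑ ‖R_n‖ converges, R(z) is norm continuous in the closed disk. Hence the leading eigenvalue 1
of R persists: R(z)v = λ(z)v with v = v(z) → h₀. Pairing with the constant 1, which R preserves,
gives (1 - λ(z))⟨v, 1⟩ = ⟨(R(1) - R(z))v, 1⟩ = ∑ (1 - z^n)⟨1_{Y_n} v, 1⟩. For v = h₀ the right side
would be ∑ q_n (1 - z^n). The bound |⟨1_{Y_n} h, 1⟩| ≤ C‖h‖μ(Y_n) makes the error at most C‖v - h₀‖
∑ q_n |1 - z^n|. By `isEquivalent_massTransform` the main sum is asymptotic to Γ(1 - β) ℓ(1/|s|)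
s^β, and by `isBigO_massTransform_norm` the sum of absolute values has the same order. As ‖v - h₀‖ →
0 and ⟨v, 1⟩ → 1, the error is relatively small; no rate of convergence of R(z) to R enters.

The identities for ⟨R h, 1⟩ and ⟨R_n h, 1⟩ come from duality on L¹(Y, m), so they hold only on the
closed span V of B ∩ L¹, which need not be B. It contains h₀ (the limit of R^n 1) and is preserved
by every R(z); `IsLeadingEigenvalue.exists_perturbation` therefore also keeps v in V.

Perturbation: R = N + ξ ⊗ h₀ with N of spectral radius less than 1. For A near R, A - ξ ⊗ h₀ has a
uniformly bounded resolvent off a disk, and the eigenvalues of A there are the fixed points of a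
scalar contraction.

Abelian theorem: with T the tail of the masses, the main sum is formally ∫ s e^{-sx} T(x) dx. On the
imaginary axis this integral need not converge absolutely, so it is cut at K/|s|, with errors that
are uniform in arg s. After rescaling to |s| = 1, regular variation and a Potter bound replace T by
y^{-β}. -/

noncomputable section

/-! ### Resolvent bounds and spectral decomposition at a leading eigenvalue -/

section Perturbation

variable {B : Type*} [NormedAddCommGroup B] [NormedSpace ℂ B] [CompleteSpace B]

/-- If `‖Y ^ k‖ ≤ q < 1`, then `1 - Y` has a bounded inverse, which preserves every closed subspace
preserved by `Y`. -/
theorem exists_inverse_one_sub_of_norm_pow_le [Nontrivial B] (Y : B →L[ℂ] B) (k : ℕ) {q b : ℝ}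
    (hq : q < 1) (hb : ‖Y‖ ≤ b) (hY : ‖Y ^ k‖ ≤ q) :
    ∃ G : B →L[ℂ] B, G * (1 - Y) = 1 ∧ (1 - Y) * G = 1 ∧
      ‖G‖ ≤ (∑ i ∈ Finset.range k, b ^ i) * (1 - q)⁻¹ ∧
      ∀ V : Submodule ℂ B, IsClosed (V : Set B) → (∀ x ∈ V, Y x ∈ V) → ∀ x ∈ V, G x ∈ V := by
  have hlt : ‖Y ^ k‖ < 1 := hY.trans_lt hq
  have hsm := summable_geometric_of_norm_lt_one hlt
  -- Only the k-th power contracts. With S the finite geometric sum, (1 - Y)S = 1 - Y^k, so the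
  -- inverse is S times the Neumann series Q of Y^k, and its bound depends on k, b and q alone.
  set Q : B →L[ℂ] B := ∑' j : ℕ, (Y ^ k) ^ j with hQ
  set S : B →L[ℂ] B := ∑ i ∈ Finset.range k, Y ^ i with hS
  have hS1 : (1 - Y) * S = 1 - Y ^ k := mul_neg_geom_sum Y k
  have hS2 : S * (1 - Y) = 1 - Y ^ k := geom_sum_mul_neg Y k
  have hQ1 : (1 - Y ^ k) * Q = 1 := mul_neg_geom_series _ hlt
  have hQ2 : Q * (1 - Y ^ k) = 1 := geom_series_mul_neg _ hlt
  have hcomm : (1 - Y) * (S * Q) = 1 := by rw [← mul_assoc, hS1, hQ1]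
  have hcomm' : (Q * S) * (1 - Y) = 1 := by rw [mul_assoc, hS2, hQ2]
  have hSQ : Q * S = S * Q := by
    calc Q * S = Q * S * ((1 - Y) * (S * Q)) := by rw [hcomm, mul_one]
      _ = S * Q := by rw [← mul_assoc, hcomm', one_mul]
  refine ⟨S * Q, hSQ ▸ hcomm', hcomm, ?_, ?_⟩
  · refine (norm_mul_le _ _).trans (mul_le_mul ?_ ?_ (norm_nonneg _) ?_)
    · refine (norm_sum_le _ _).trans (Finset.sum_le_sum fun i _ => ?_)
      exact (norm_pow_le Y i).trans (pow_le_pow_left₀ (norm_nonneg _) hb i)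
    · refine (tsum_geometric_le_of_norm_lt_one _ hlt).trans ?_
      rw [norm_one, sub_self, zero_add]
      exact inv_anti₀ (by linarith) (by linarith)
    · exact Finset.sum_nonneg fun i _ => pow_nonneg ((norm_nonneg _).trans hb) i
  · intro V hV hYV
    -- The inverse is a limit of polynomials in Y, so closed subspaces preserved by Y are preserved.
    have hpow : ∀ i : ℕ, ∀ x ∈ V, (Y ^ i) x ∈ V := by
      intro i
      induction i with
      | zero => intro x hx; simpa using hx
      | succ i ih => intro x hx; rw [pow_succ']; exact hYV _ (ih x hx)
    intro x hx
    have hQV : Q x ∈ V := by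
      have h1 : HasSum (fun j : ℕ => ((Y ^ k) ^ j) x) (Q x) :=
        hsm.hasSum.mapL (ContinuousLinearMap.apply ℂ B x)
      refine hV.mem_of_tendsto h1 (Eventually.of_forall fun s => V.sum_mem fun j _ => ?_)
      rw [← pow_mul]
      exact hpow _ x hx
    change S (Q x) ∈ V
    rw [hS, sum_apply]
    exact V.sum_mem fun i _ => hpow i _ hQV

/-- Uniform resolvent bounds outside a disk containing the spectrum, for operators close to `N`. -/
theorem exists_uniform_resolvent [Nontrivial B] (N : B →L[ℂ] B) {r : ℝ} (hr : 0 < r)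
    (hN : spectralRadius ℂ N < ENNReal.ofReal r) :
    ∃ η > 0, ∃ C > 0, ∀ X : B →L[ℂ] B, ‖X - N‖ < η → ∀ w : ℂ, r ≤ ‖w‖ →
      ∃ G : B →L[ℂ] B, G * (X - w • 1) = 1 ∧ (X - w • 1) * G = 1 ∧ ‖G‖ ≤ C ∧
        ∀ V : Submodule ℂ B, IsClosed (V : Set B) → (∀ x ∈ V, X x ∈ V) → ∀ x ∈ V, G x ∈ V := by
  -- By Gelfand's formula one power k works. The strict inequality is an open condition, so it
  -- survives near N; for ‖w‖ ≥ r the power (w⁻¹X)^k is at most ‖X^k‖ / r^k, hence the same k serves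
  -- all w.
  obtain ⟨k, hk⟩ : ∃ k : ℕ, ‖N ^ k‖ < r ^ k := by
    have h1 := spectrum.pow_norm_pow_one_div_tendsto_nhds_spectralRadius N
    obtain ⟨k, hk, hk0⟩ := ((h1.eventually_lt_const hN).and (eventually_gt_atTop 0)).exists
    refine ⟨k, ?_⟩
    have h2 := (ENNReal.ofReal_lt_ofReal_iff hr).1 hk
    have h3 := pow_lt_pow_left₀ h2 (by positivity) hk0.ne'
    rwa [one_div, Real.rpow_inv_natCast_pow (norm_nonneg _) hk0.ne'] at h3
  obtain ⟨q', hq1, hq2⟩ := exists_between hk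
  have hcont : Tendsto (fun X : B →L[ℂ] B => ‖X ^ k‖) (𝓝 N) (𝓝 ‖N ^ k‖) :=
    ((continuous_pow k).norm).tendsto N
  obtain ⟨η, hη, hball⟩ := Metric.eventually_nhds_iff.1 (hcont.eventually_lt_const hq1)
  have hrk : 0 < r ^ k := pow_pos hr k
  have hq0 : 0 ≤ q' := (norm_nonneg _).trans hq1.le
  set b : ℝ := (‖N‖ + η) / r
  set C := (∑ i ∈ Finset.range k, b ^ i) * (1 - q' / r ^ k)⁻¹
  -- The summand 1 only makes the constant positive.
  refine ⟨η, hη, C * r⁻¹ + 1, ?_, fun X hX w hw => ?_⟩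
  · have : 0 ≤ C := mul_nonneg (Finset.sum_nonneg fun i _ => by positivity)
      (inv_nonneg.2 (sub_nonneg.2 ((div_le_one hrk).2 hq2.le)))
    positivity
  have hw0 : 0 < ‖w‖ := hr.trans_le hw
  have hw1 : w ≠ 0 := norm_pos_iff.1 hw0
  obtain ⟨G, h1, h2, h3, h4⟩ := exists_inverse_one_sub_of_norm_pow_le (w⁻¹ • X) k
    (q := q' / r ^ k) (b := b) ((div_lt_one hrk).2 hq2)
    (by
      rw [norm_smul, norm_inv, ← div_eq_inv_mul]
      have : ‖X‖ ≤ ‖N‖ + η := by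
        calc ‖X‖ = ‖N + (X - N)‖ := by rw [add_sub_cancel]
          _ ≤ ‖N‖ + ‖X - N‖ := norm_add_le _ _
          _ ≤ _ := by gcongr
      exact div_le_div₀ (by positivity) this hr hw)
    (by
      rw [smul_pow, norm_smul, norm_pow, norm_inv, inv_pow, ← div_eq_inv_mul]
      exact div_le_div₀ hq0 (hball (by rwa [dist_eq_norm])).le hrk
        (pow_le_pow_left₀ hr.le hw k))
  have hX' : X - w • 1 = (-w) • (1 - w⁻¹ • X) := by
    rw [smul_sub, smul_smul, neg_mul, mul_inv_cancel₀ hw1]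
    simp only [neg_smul, one_smul]
    abel
  refine ⟨(-w)⁻¹ • G, ?_, ?_, ?_, fun V hV hXV x hx => V.smul_mem _ (h4 V hV ?_ x hx)⟩
  · rw [hX', smul_mul_smul_comm, h1, inv_mul_cancel₀ (neg_ne_zero.2 hw1), one_smul]
  · rw [hX', smul_mul_smul_comm, h2, mul_inv_cancel₀ (neg_ne_zero.2 hw1), one_smul]
  · rw [norm_smul, norm_inv, norm_neg, mul_comm]
    have : ‖G‖ * ‖w‖⁻¹ ≤ C * r⁻¹ :=
      mul_le_mul h3 (inv_anti₀ hr hw) (by positivity) ((norm_nonneg _).trans h3)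
    linarith
  · exact fun x hx => V.smul_mem _ (hXV x hx)

/-- The spectral decomposition of an operator at a leading eigenvalue `1`. -/
theorem IsLeadingEigenvalue.exists_decomposition {R : B →L[ℂ] B} (hgap : IsLeadingEigenvalue R 1)
    {h0 : B} (hh : R h0 = h0) (hne : h0 ≠ 0) :
    ∃ ξ : B →L[ℂ] ℂ, ξ h0 = 1 ∧ (∀ x, ξ (R x) = ξ x) ∧
      ∃ r : ℝ, 0 < r ∧ r < 1 ∧ spectralRadius ℂ (R - ξ.smulRight h0) < ENNReal.ofReal r := by
  have : Nontrivial B := ⟨⟨h0, 0, hne⟩⟩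
  obtain ⟨⟨hdim, hcompl⟩, r0, hr0, hspec⟩ := hgap
  rw [norm_one] at hr0
  have hK : ∀ x, R x = x → ∃ a : ℂ, x = a • h0 := by
    intro x hx
    have hmem : ∀ y, R y = y → y ∈ LinearMap.ker ((R - (1 : ℂ) • ContinuousLinearMap.id ℂ B :
        B →L[ℂ] B) : B →ₗ[ℂ] B) := by
      intro y hy
      simp [hy]
    obtain ⟨a, ha⟩ := (finrank_eq_one_iff_of_nonzero' (⟨h0, hmem h0 hh⟩ : LinearMap.ker _)
      (fun h => hne (congrArg Subtype.val h))).1 hdim ⟨x, hmem x hx⟩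
    exact ⟨a, (congrArg Subtype.val ha).symm⟩
  have hdisj : ∀ x y, R x - x = y → R y = y → y = 0 := by
    intro x y hx hy
    have := Submodule.disjoint_def.1 hcompl.disjoint y (by simp [hy]) ⟨x, by simpa using hx⟩
    exact this
  have hspan : ∀ y, ∃ (a : ℂ) (x : B), y = a • h0 + (R x - x) := by
    intro y
    obtain ⟨u, hu, v, ⟨x, hx⟩, huv⟩ := Submodule.mem_sup.1
      (hcompl.sup_eq_top ▸ Submodule.mem_top : y ∈ _ ⊔ _)
    obtain ⟨a, ha⟩ := hK u (by simpa [sub_eq_zero] using hu)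
    exact ⟨a, x, by rw [← huv, ← ha, ← hx]; simp⟩
  -- The rank one term η ⊗ h₀ fills the defect of R - 1, so T is invertible, with bounded inverse by
  -- the open mapping theorem. Then ξ = η ∘ T⁻¹ is the invariant functional of the spectral
  -- projection: T(x - η(x)h₀) = Rx - x, and η vanishes at x - η(x)h₀.
  obtain ⟨η, hη⟩ := SeparatingDual.exists_eq_one (R := ℂ) hne
  set T : B →L[ℂ] B := R - 1 + η.smulRight h0 with hT
  have hTx : ∀ x, T x = R x - x + η x • h0 := fun x => by simp [hT]
  have hTbij : Function.Bijective T := by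
    constructor
    · rw [injective_iff_map_eq_zero]
      intro x hx
      rw [hTx] at hx
      have h1 : η x • h0 = 0 := by
        refine hdisj (-x) _ ?_ (by rw [map_smul, hh])
        rw [map_neg, neg_sub_neg, ← sub_eq_zero, ← neg_eq_zero, ← hx]
        abel
      have h2 : η x = 0 := (smul_eq_zero.1 h1).resolve_right hne
      obtain ⟨a, rfl⟩ := hK x (by rwa [h1, add_zero, sub_eq_zero] at hx)
      rw [map_smul, hη, smul_eq_mul, mul_one] at h2
      rw [h2, zero_smul]
    · intro y
      obtain ⟨a, x, rfl⟩ := hspan y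
      refine ⟨x + (a - η x) • h0, ?_⟩
      rw [hTx]
      simp only [map_add, map_smul, hh, hη, smul_eq_mul, mul_one, add_sub_cancel]
      abel
  obtain ⟨T', hT'⟩ := ContinuousLinearMap.isUnit_iff_bijective.2 hTbij
  have hinv : ∀ x, (↑T'⁻¹ : B →L[ℂ] B) (T x) = x := fun x => by
    have : (↑T'⁻¹ : B →L[ℂ] B) * T = 1 := by rw [← hT', Units.inv_mul]
    exact congrArg (fun L : B →L[ℂ] B => L x) this
  set ξ : B →L[ℂ] ℂ := η.comp (↑T'⁻¹ : B →L[ℂ] B) with hξ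
  have hξT : ∀ x, ξ (T x) = η x := fun x => by simp only [hξ, ContinuousLinearMap.comp_apply, hinv]
  have hξ0 : ξ h0 = 1 := by
    rw [← hη, ← hξT h0, hTx, hh, sub_self, zero_add, hη, one_smul]
  have hξR : ∀ x, ξ (R x) = ξ x := by
    intro x
    have h1 : T (x - η x • h0) = R x - x := by
      rw [hTx]; simp [hh, hη]
    rw [← sub_eq_zero, ← map_sub, ← h1, hξT]
    simp [hη]
  -- The radius lies halfway between r₀ and 1; the maximum with 1/2 is taken because r₀ need not be
  -- positive.
  refine ⟨ξ, hξ0, hξR, max ((1 + r0) / 2) (1 / 2), by positivity,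
    max_lt (by linarith) (by norm_num), ?_⟩
  set r := max ((1 + r0) / 2) (1 / 2) with hr
  have hrpos : 0 < r := by positivity
  set N := R - ξ.smulRight h0 with hN
  have hNx : ∀ x, N x = R x - ξ x • h0 := fun x => by simp [hN]
  -- Subtracting ξ ⊗ h₀ moves the eigenvalue 1 to 0. Since N h₀ = 0, a multiple of h₀ corrects a
  -- preimage under R - w to one under N - w; for w = 1 the splitting into kernel and range is used
  -- instead.
  have hunit : ∀ w : ℂ, r ≤ ‖w‖ → w ∉ spectrum ℂ N := by
    intro w hw
    have hw0 : w ≠ 0 := norm_pos_iff.1 (hrpos.trans_le hw)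
    rw [spectrum.notMem_iff, ← IsUnit.sub_iff, ContinuousLinearMap.isUnit_iff_bijective]
    have hev : ∀ x, (N - algebraMap ℂ (B →L[ℂ] B) w) x = R x - ξ x • h0 - w • x := fun x => by
      simp [hNx, Algebra.algebraMap_eq_smul_one]
    have hker : ∀ x, R x - ξ x • h0 - w • x = 0 → ξ x = 0 ∧ R x = w • x := by
      intro x hx
      have h1 := congrArg ξ hx
      simp only [map_sub, map_smul, hξR, hξ0, smul_eq_mul, mul_one, sub_self, zero_sub, map_zero,
        neg_eq_zero, mul_eq_zero, hw0, false_or] at h1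
      rw [h1, zero_smul, sub_zero, sub_eq_zero] at hx
      exact ⟨h1, hx⟩
    rcases eq_or_ne w 1 with rfl | hw1
    · constructor
      · rw [injective_iff_map_eq_zero]
        intro x hx
        rw [hev] at hx
        obtain ⟨h1, h2⟩ := hker x hx
        obtain ⟨a, rfl⟩ := hK x (by rwa [one_smul] at h2)
        rw [map_smul, hξ0, smul_eq_mul, mul_one] at h1
        rw [h1, zero_smul]
      · intro y
        obtain ⟨a, x, rfl⟩ := hspan y
        refine ⟨x - (a + ξ x) • h0, ?_⟩
        rw [hev]
        simp only [map_sub, map_add, map_smul, hh, hξ0, smul_eq_mul, mul_one, sub_smul, add_smul, one_smul]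
        abel
    · have hRw : w ∉ spectrum ℂ R := by
        intro hmem
        have h1 := hspec w hmem hw1
        have h2 : r0 < r := lt_of_lt_of_le (by linarith) (le_max_left _ _)
        linarith
      rw [spectrum.notMem_iff, ← IsUnit.sub_iff, ContinuousLinearMap.isUnit_iff_bijective] at hRw
      have hevR : ∀ x, (R - algebraMap ℂ (B →L[ℂ] B) w) x = R x - w • x := fun x => by
        simp [Algebra.algebraMap_eq_smul_one]
      constructor
      · rw [injective_iff_map_eq_zero]
        intro x hx
        rw [hev] at hx
        obtain ⟨h1, h2⟩ := hker x hx
        apply hRw.1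
        rw [hevR, map_zero, h2, sub_self]
      · intro y
        obtain ⟨x, hx⟩ := hRw.2 y
        rw [hevR] at hx
        refine ⟨x - (ξ x / w) • h0, ?_⟩
        rw [hev, ← hx]
        simp only [map_sub, map_smul, hh, hξ0, smul_eq_mul, mul_one, sub_smul, smul_sub, smul_smul,
          mul_div_cancel₀ _ hw0]
        abel
  have hlt := spectrum.spectralRadius_lt_of_forall_lt N (r := ⟨r, hrpos.le⟩) (fun z hz => by
    by_contra hcon
    exact hunit z (not_lt.1 hcon) hz)
  rwa [ENNReal.ofReal_eq_coe_nnreal hrpos.le]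

end Perturbation

/-! ### Stability of the leading eigenvalue and eigenvector -/

section Perturbation

variable {B : Type*} [NormedAddCommGroup B] [NormedSpace ℂ B]

theorem norm_resolvent_functional_le {ξ : B →L[ℂ] ℂ} {G₁ G₂ : B →L[ℂ] B} {C : ℝ} (d : B)
    (h₁ : ‖G₁‖ ≤ C) (h₂ : ‖G₂‖ ≤ C) : ‖ξ (G₁ (G₂ d))‖ ≤ ‖ξ‖ * C ^ 2 * ‖d‖ := by
  have hC : 0 ≤ C := (norm_nonneg _).trans h₁
  calc ‖ξ (G₁ (G₂ d))‖ ≤ ‖ξ‖ * (‖G₁‖ * (‖G₂‖ * ‖d‖)) :=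
        (ξ.le_opNorm _).trans (mul_le_mul_of_nonneg_left ((G₁.le_opNorm _).trans
          (mul_le_mul_of_nonneg_left (G₂.le_opNorm _) (norm_nonneg _))) (norm_nonneg _))
    _ ≤ ‖ξ‖ * (C * (C * ‖d‖)) := by gcongr
    _ = _ := by ring

/-- The resolvent identity, tested against `ξ` and `d`. -/
theorem norm_resolvent_sub_le {X : B →L[ℂ] B} {ξ : B →L[ℂ] ℂ} {G₁ G₂ : B →L[ℂ] B} {C : ℝ}
    {w₁ w₂ : ℂ} (d : B) (hG₁ : ∀ x, G₁ (X x - w₁ • x) = x)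
    (hG₂ : ∀ x, X (G₂ x) - w₂ • G₂ x = x)
    (h₁ : ‖G₁‖ ≤ C) (h₂ : ‖G₂‖ ≤ C) :
    ‖ξ (G₁ d) - ξ (G₂ d)‖ ≤ ‖ξ‖ * C ^ 2 * ‖d‖ * ‖w₁ - w₂‖ := by
  have h : G₁ d - G₂ d = (w₁ - w₂) • G₁ (G₂ d) := by
    have e1 : d = (X (G₂ d) - w₁ • G₂ d) + (w₁ - w₂) • G₂ d := by
      conv_lhs => rw [← hG₂ d]
      rw [sub_smul]; abel
    conv_lhs => rw [e1]
    rw [map_add, hG₁, map_smul, ← e1]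
    abel
  rw [← map_sub, h, map_smul, norm_smul, mul_comm]
  exact mul_le_mul_of_nonneg_right (norm_resolvent_functional_le d h₁ h₂) (norm_nonneg _)

/-- A rank one perturbation `X + ξ ⊗ h₀` has the leading eigenvalue `lam` if `lam` solves the
characteristic equation `ξ (h₀ - (X - lam)⁻¹ X h₀) = lam`. -/
theorem isLeadingEigenvalue_of_characteristic [CompleteSpace B] {X : B →L[ℂ] B} {ξ : B →L[ℂ] ℂ}
    {h0 : B} {r C : ℝ} (hr : 0 < r) {G : ℂ → B →L[ℂ] B}
    (hG : ∀ w, r ≤ ‖w‖ → ∀ x, G w (X x - w • x) = x)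
    (hG' : ∀ w, r ≤ ‖w‖ → ∀ x, X (G w x) - w • G w x = x) (hC : ∀ w, r ≤ ‖w‖ → ‖G w‖ ≤ C)
    (hsmall : ‖ξ‖ * C ^ 2 * ‖X h0‖ < 1) {lam : ℂ} (hlam : r < ‖lam‖)
    (hfix : ξ (h0 - G lam (X h0)) = lam) :
    IsLeadingEigenvalue (X + ξ.smulRight h0) lam ∧
      (X + ξ.smulRight h0) (h0 - G lam (X h0)) = lam • (h0 - G lam (X h0)) := by
  set A := X + ξ.smulRight h0 with hA
  have hAx : ∀ x, A x = X x + ξ x • h0 := fun x => by simp [hA]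
  -- Since (X - w) v_w = -w h₀, one has A v_w = w v_w + (ξ(v_w) - w) h₀. So v_w is an eigenvector
  -- when ξ(v_w) = w, and every eigenvector for w is a multiple of it.
  set v : ℂ → B := fun w => h0 - G w (X h0) with hv
  have hXv : ∀ w, r ≤ ‖w‖ → X (v w) - w • v w = -(w • h0) := by
    intro w hw
    simp only [hv, map_sub, smul_sub]
    rw [sub_sub_sub_comm, hG' w hw]
    abel
  have hne : ∀ w : ℂ, r ≤ ‖w‖ → w ≠ 0 := fun w hw => norm_pos_iff.1 (hr.trans_le hw)
  have hlam0 := hne lam hlam.le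
  have hAv : A (v lam) = lam • v lam := by
    have h1 := hXv lam hlam.le
    rw [hAx]
    rw [sub_eq_iff_eq_add] at h1
    rw [h1, hfix]; abel
  have hker : ∀ w, r ≤ ‖w‖ → ∀ x, A x = w • x → x = (ξ x / w) • v w := by
    intro w hw x hx
    have h1 : X x - w • x = X ((ξ x / w) • v w) - w • (ξ x / w) • v w := by
      rw [map_smul, smul_comm w, ← smul_sub, hXv w hw, smul_neg, smul_smul,
        div_mul_cancel₀ _ (hne w hw), ← hx, hAx]
      abel
    calc x = G w (X x - w • x) := (hG w hw x).symm
      _ = _ := by rw [h1, hG w hw]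
  refine ⟨⟨⟨?_, ?_⟩, r, hlam, ?_⟩, hAv⟩
  · have hmem : v lam ∈ LinearMap.ker ((A - lam • ContinuousLinearMap.id ℂ B :
        B →L[ℂ] B) : B →ₗ[ℂ] B) := by
      simp [hAv]
    have hv0 : v lam ≠ 0 := by
      intro h
      apply hlam0
      rw [← hfix]
      change ξ (v lam) = 0
      rw [h, map_zero]
    refine (finrank_eq_one_iff_of_nonzero' (⟨v lam, hmem⟩ : LinearMap.ker _)
      (fun h => hv0 (congrArg Subtype.val h))).2 ?_
    rintro ⟨x, hx⟩
    refine ⟨ξ x / lam, Subtype.ext ?_⟩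
    exact (hker lam hlam.le x (by simpa [sub_eq_zero] using hx)).symm
  · have hGh : G lam h0 = -(lam⁻¹ • v lam) := by
      have h1 := hG lam hlam.le (v lam)
      rw [hXv lam hlam.le, map_neg, map_smul] at h1
      rw [← h1, smul_neg, neg_neg, smul_smul, inv_mul_cancel₀ hlam0, one_smul]
    -- The functional y ↦ ξ(G y) has the range of A - lam as its kernel, so simplicity means that it
    -- does not vanish at v. Its value there is -1 up to a term that `hsmall` makes smaller than 1.
    have hGv : ξ (G lam (v lam)) = -1 - ξ (G lam (G lam (X h0))) := by
      simp only [hv, map_sub]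
      rw [hGh]
      simp only [map_neg, map_smul]
      rw [show ξ (v lam) = lam from hfix, smul_eq_mul, inv_mul_cancel₀ hlam0]
    have hGv0 : ξ (G lam (v lam)) ≠ 0 := by
      intro h
      rw [hGv, sub_eq_zero] at h
      have h1 := norm_resolvent_functional_le (ξ := ξ) (X h0) (hC lam hlam.le) (hC lam hlam.le)
      rw [← h, norm_neg, norm_one] at h1
      linarith
    constructor
    · rw [Submodule.disjoint_def]
      rintro x hx ⟨y, hy⟩
      have hx' : x = (ξ x / lam) • v lam :=
        hker lam hlam.le x (by simpa [sub_eq_zero] using hx)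
      set a := ξ x / lam
      have hy' : X y + ξ y • h0 - lam • y = x := by
        rw [← hAx]; simpa using hy
      have h1 : X (y - (ξ y / lam) • v lam) - lam • (y - (ξ y / lam) • v lam) = x := by
        rw [map_sub, map_smul, smul_sub, sub_sub_sub_comm, smul_comm lam, ← smul_sub,
          hXv lam hlam.le, smul_neg, smul_smul, div_mul_cancel₀ _ hlam0, ← hy']
        abel
      have h2 := hG lam hlam.le (y - (ξ y / lam) • v lam)
      rw [h1] at h2
      have h3 := congrArg ξ h2
      rw [map_sub, map_smul, show ξ (v lam) = lam from hfix, smul_eq_mul,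
        div_mul_cancel₀ _ hlam0, sub_self, hx', map_smul, map_smul, smul_eq_mul, mul_eq_zero] at h3
      rw [hx', h3.resolve_right hGv0, zero_smul]
    · rw [codisjoint_iff, eq_top_iff]
      intro y _
      set a := ξ (G lam y) / ξ (G lam (v lam)) with ha
      have h1 : ξ (G lam (y - a • v lam)) = 0 := by
        rw [map_sub, map_sub, map_smul, map_smul, smul_eq_mul, ha, div_mul_cancel₀ _ hGv0, sub_self]
      refine Submodule.mem_sup.2 ⟨a • v lam, ?_, y - a • v lam, ⟨G lam (y - a • v lam), ?_⟩, ?_⟩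
      · simp [hAv]
      · have : A (G lam (y - a • v lam)) - lam • G lam (y - a • v lam) = y - a • v lam := by
          rw [hAx, h1, zero_smul, add_zero, hG' lam hlam.le]
        simpa using this
      · abel
  · intro w hw hwne
    by_contra hcon
    have hrw : r ≤ ‖w‖ := (not_le.1 hcon).le
    have hw0 := hne w hrw
    -- By the resolvent identity, w ↦ ξ(v_w) has Lipschitz constant less than 1 off the disk, so lam
    -- is its only fixed point there.
    have hψ : ξ (v w) ≠ w := by
      intro h
      have h1 := norm_resolvent_sub_le (ξ := ξ) (X h0) (hG w hrw) (hG' lam hlam.le)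
        (hC w hrw) (hC lam hlam.le)
      have h2 : ξ (G w (X h0)) - ξ (G lam (X h0)) = lam - w := by
        have h3 : ξ h0 - ξ (G w (X h0)) = w := by rw [← map_sub]; exact h
        have h4 : ξ h0 - ξ (G lam (X h0)) = lam := by rw [← map_sub]; exact hfix
        linear_combination h4 - h3
      rw [h2, ← norm_neg, neg_sub] at h1
      have h3 : 0 < ‖w - lam‖ := norm_pos_iff.2 (sub_ne_zero.2 hwne)
      nlinarith
    refine hw (?_ : IsUnit _)
    rw [← IsUnit.sub_iff, ContinuousLinearMap.isUnit_iff_bijective]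
    have hev : ∀ x, (A - algebraMap ℂ (B →L[ℂ] B) w) x = A x - w • x := fun x => by
      simp [Algebra.algebraMap_eq_smul_one]
    constructor
    · rw [injective_iff_map_eq_zero]
      intro x hx
      rw [hev, sub_eq_zero] at hx
      have h1 := hker w hrw x hx
      have h2 := congrArg ξ h1
      rw [map_smul, smul_eq_mul, div_mul_eq_mul_div, eq_div_iff hw0] at h2
      have h3 : ξ x = 0 := by
        by_contra h4
        exact hψ (mul_left_cancel₀ h4 h2).symm
      rw [h1, h3, zero_div, zero_smul]
    · intro y
      -- This a cancels the h₀ component: (A - w)(G y + a v_w) = y + (ξ(G y) + a(ξ(v_w) - w)) h₀.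
      set a := ξ (G w y) / (w - ξ (v w)) with ha
      refine ⟨G w y + a • v w, ?_⟩
      have h1 := hXv w hrw
      have h2 := hG' w hrw y
      rw [sub_eq_iff_eq_add] at h1 h2
      rw [hev, hAx, map_add, map_smul, h1, h2, map_add, map_smul, smul_eq_mul]
      have h3 : ξ (G w y) + a * ξ (v w) = a * w := by
        rw [ha]; field_simp [sub_ne_zero.2 hψ.symm]; ring
      rw [h3]
      simp only [smul_add, smul_smul, smul_neg, mul_comm w]
      abel

/-- Leading eigenvalues are stable under small perturbations; the eigenvalue and the eigenvector
depend in a Lipschitz way on the operator, and the eigenvector stays in every closed invariant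
subspace containing the unperturbed one. -/
theorem IsLeadingEigenvalue.exists_perturbation [CompleteSpace B] {R : B →L[ℂ] B}
    (hgap : IsLeadingEigenvalue R 1) {h0 : B} (hh : R h0 = h0) (hne : h0 ≠ 0) :
    ∃ δ > 0, ∃ K : ℝ, ∀ A : B →L[ℂ] B, ‖A - R‖ < δ → ∃ lam : ℂ, ∃ v : B,
      IsLeadingEigenvalue A lam ∧ A v = lam • v ∧ ‖v - h0‖ ≤ K * ‖A - R‖ ∧
      ∀ V : Submodule ℂ B, IsClosed (V : Set B) → h0 ∈ V → (∀ x ∈ V, A x ∈ V) → v ∈ V := by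
  have : Nontrivial B := ⟨⟨h0, 0, hne⟩⟩
  obtain ⟨ξ, hξ0, hξR, r, hr0, hr1, hspec⟩ := hgap.exists_decomposition hh hne
  set N := R - ξ.smulRight h0 with hN
  obtain ⟨η, hη, C, hC0, hres⟩ := exists_uniform_resolvent N hr0 hspec
  -- The two summands control the Lipschitz constant of ψ and its displacement from 1. As X h₀ = (A
  -- - R) h₀, both are O(‖A - R‖), and δ makes both at most (1 - r)/2: then ψ maps the disk D into
  -- itself, contracts by 1/2, and D avoids the disk of radius r.
  set M := ‖ξ‖ * C ^ 2 * ‖h0‖ + ‖ξ‖ * C * ‖h0‖ with hM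
  have hM0 : 0 ≤ M := by positivity
  refine ⟨min η ((1 - r) / (2 * (M + 1))), lt_min hη (div_pos (by linarith) (by linarith)),
    C * ‖h0‖, fun A hAR => ?_⟩
  set X := A - ξ.smulRight h0 with hX
  have hXN : X - N = A - R := by rw [hX, hN]; abel
  have hd : ‖X h0‖ ≤ ‖A - R‖ * ‖h0‖ := by
    have : X h0 = (A - R) h0 := by simp [hX, hξ0, hh]
    rw [this]
    exact (A - R).le_opNorm h0
  have hAR1 : ‖X - N‖ < η := by rw [hXN]; exact hAR.trans_le (min_le_left _ _)
  have hAR2 : M * ‖A - R‖ ≤ (1 - r) / 2 := by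
    have h1 := (hAR.trans_le (min_le_right _ _)).le
    rw [le_div_iff₀ (by linarith)] at h1
    nlinarith [norm_nonneg (A - R)]
  have hb1 : ‖ξ‖ * C ^ 2 * ‖X h0‖ ≤ (1 - r) / 2 := by
    refine le_trans ?_ hAR2
    calc ‖ξ‖ * C ^ 2 * ‖X h0‖ ≤ ‖ξ‖ * C ^ 2 * (‖A - R‖ * ‖h0‖) := by gcongr
      _ = (‖ξ‖ * C ^ 2 * ‖h0‖) * ‖A - R‖ := by ring
      _ ≤ M * ‖A - R‖ := by
        gcongr
        rw [hM]
        exact le_add_of_nonneg_right (by positivity)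
  have hb2 : ‖ξ‖ * C * ‖X h0‖ ≤ (1 - r) / 2 := by
    refine le_trans ?_ hAR2
    calc ‖ξ‖ * C * ‖X h0‖ ≤ ‖ξ‖ * C * (‖A - R‖ * ‖h0‖) := by gcongr
      _ = (‖ξ‖ * C * ‖h0‖) * ‖A - R‖ := by ring
      _ ≤ M * ‖A - R‖ := by
        gcongr
        rw [hM]
        exact le_add_of_nonneg_left (by positivity)
  choose! G hG1 hG2 hGC hGV using hres X hAR1
  have hG : ∀ w, r ≤ ‖w‖ → ∀ x, G w (X x - w • x) = x := fun w hw x => by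
    simpa using congrArg (fun L : B →L[ℂ] B => L x) (hG1 w hw)
  have hG' : ∀ w, r ≤ ‖w‖ → ∀ x, X (G w x) - w • G w x = x := fun w hw x => by
    simpa using congrArg (fun L : B →L[ℂ] B => L x) (hG2 w hw)
  set ψ : ℂ → ℂ := fun w => ξ (h0 - G w (X h0)) with hψ
  set D : Set ℂ := Metric.closedBall 1 ((1 - r) / 2)
  have hD : ∀ w ∈ D, r < ‖w‖ := by
    intro w hw
    have h1 : ‖w - 1‖ ≤ (1 - r) / 2 := mem_closedBall_iff_norm.1 hw
    have h2 := norm_sub_norm_le (1 : ℂ) w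
    rw [norm_one, norm_sub_rev] at h2
    linarith
  have hmaps : MapsTo ψ D D := by
    intro w hw
    refine mem_closedBall_iff_norm.2 ?_
    have h1 : ψ w - 1 = -ξ (G w (X h0)) := by simp [hψ, hξ0]
    rw [h1, norm_neg]
    refine le_trans ?_ hb2
    calc ‖ξ (G w (X h0))‖ ≤ ‖ξ‖ * (‖G w‖ * ‖X h0‖) :=
          (ξ.le_opNorm _).trans (mul_le_mul_of_nonneg_left ((G w).le_opNorm _) (norm_nonneg _))
      _ ≤ ‖ξ‖ * (C * ‖X h0‖) := by
          gcongr
          exact hGC w (hD w hw).le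
      _ = _ := by ring
  have hcontr : ContractingWith ⟨1 / 2, by norm_num⟩ (hmaps.restrict ψ D D) := by
    refine ⟨show ((1 : ℝ) / 2) < 1 by norm_num, LipschitzWith.of_dist_le_mul ?_⟩
    rintro ⟨w₁, h1⟩ ⟨w₂, h2⟩
    change dist (ψ w₁) (ψ w₂) ≤ (1 / 2) * dist w₁ w₂
    rw [dist_eq_norm, dist_eq_norm]
    have h3 : ψ w₁ - ψ w₂ = -(ξ (G w₁ (X h0)) - ξ (G w₂ (X h0))) := by
      simp only [hψ, map_sub]; ring
    rw [h3, norm_neg]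
    refine (norm_resolvent_sub_le (ξ := ξ) (X h0) (hG w₁ (hD w₁ h1).le) (hG' w₂ (hD w₂ h2).le)
      (hGC w₁ (hD w₁ h1).le) (hGC w₂ (hD w₂ h2).le)).trans ?_
    exact mul_le_mul_of_nonneg_right (by linarith) (norm_nonneg _)
  obtain ⟨lam, hlamD, hlam, -⟩ := hcontr.exists_fixedPoint'
    (Metric.isClosed_closedBall.isComplete) hmaps
    (Metric.mem_closedBall_self (by linarith : (0 : ℝ) ≤ (1 - r) / 2)) (edist_ne_top _ _)
  have hAX : A = X + ξ.smulRight h0 := by rw [hX]; abel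
  obtain ⟨h1, h2⟩ := isLeadingEigenvalue_of_characteristic hr0 hG hG' hGC
    (by linarith) (hD lam hlamD) hlam
  rw [← hAX] at h1 h2
  refine ⟨lam, _, h1, h2, ?_, fun V hV hV0 hVA => ?_⟩
  · rw [sub_sub_cancel_left, norm_neg]
    calc ‖G lam (X h0)‖ ≤ ‖G lam‖ * ‖X h0‖ := (G lam).le_opNorm _
      _ ≤ C * (‖A - R‖ * ‖h0‖) := by
        gcongr
        exact hGC lam (hD lam hlamD).le
      _ = _ := by ring
  · have hXV : ∀ x ∈ V, X x ∈ V := fun x hx => by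
      have : X x = A x - ξ x • h0 := by simp [hX]
      rw [this]
      exact V.sub_mem (hVA x hx) (V.smul_mem _ hV0)
    exact V.sub_mem hV0 (hGV lam (hD lam hlamD).le V hV hXV _ (hXV _ hV0))

/-- If `R h₀ = h₀`, then the iterates of any vector converge to a multiple of `h₀`. -/
theorem IsLeadingEigenvalue.tendsto_pow [CompleteSpace B] {R : B →L[ℂ] B}
    (hgap : IsLeadingEigenvalue R 1) {h0 : B} (hh : R h0 = h0) (hne : h0 ≠ 0) (x : B) :
    ∃ a : ℂ, Tendsto (fun n : ℕ => (R ^ n) x) atTop (𝓝 (a • h0)) := by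
  have : Nontrivial B := ⟨⟨h0, 0, hne⟩⟩
  obtain ⟨ξ, hξ0, hξR, r, hr0, hr1, hspec⟩ := hgap.exists_decomposition hh hne
  set N := R - ξ.smulRight h0 with hN
  have hN0 : Tendsto (fun n : ℕ => N ^ n) atTop (𝓝 0) := by
    have h1 := (spectrum.pow_norm_pow_one_div_tendsto_nhds_spectralRadius N).eventually_lt_const
      hspec
    refine squeeze_zero_norm' (a := fun n => r ^ n) ?_
      (tendsto_pow_atTop_nhds_zero_of_lt_one hr0.le hr1)
    filter_upwards [h1, eventually_gt_atTop 0] with k hk hk0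
    have h2 := (ENNReal.ofReal_lt_ofReal_iff hr0).1 hk
    have h3 := pow_lt_pow_left₀ h2 (by positivity) hk0.ne'
    rw [one_div, Real.rpow_inv_natCast_pow (norm_nonneg _) hk0.ne'] at h3
    exact h3.le
  -- R fixes h₀, and it agrees with N on the kernel of ξ, which is invariant; there the iterates
  -- decay geometrically.
  have hpow : ∀ n : ℕ, (R ^ n) x = ξ x • h0 + (N ^ n) (x - ξ x • h0) := by
    intro n
    have hξN : ∀ n : ℕ, ξ ((N ^ n) (x - ξ x • h0)) = 0 ∧
        (R ^ n) (x - ξ x • h0) = (N ^ n) (x - ξ x • h0) := by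
      intro n
      induction n with
      | zero => simp [hξ0]
      | succ n ih =>
        rw [pow_succ', pow_succ']
        simp only [mul_apply_eq_comp]
        rw [ih.2]
        have h2 : N ((N ^ n) (x - ξ x • h0)) = R ((N ^ n) (x - ξ x • h0)) := by
          rw [hN, sub_apply, ContinuousLinearMap.smulRight_apply, ← hN, ih.1, zero_smul, sub_zero]
        rw [h2, hξR, ih.1]
        exact ⟨rfl, rfl⟩
    have hRh : ∀ n : ℕ, (R ^ n) h0 = h0 := by
      intro n
      induction n with
      | zero => simp
      | succ n ih => rw [pow_succ', mul_apply_eq_comp, ih, hh]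
    rw [← (hξN n).2, map_sub, map_smul, hRh]
    abel
  refine ⟨ξ x, ?_⟩
  simp_rw [hpow]
  have h1 : Tendsto (fun n : ℕ => (N ^ n) (x - ξ x • h0)) atTop (𝓝 0) := by
    have := ((ContinuousLinearMap.apply ℂ B (x - ξ x • h0)).continuous.tendsto 0).comp hN0
    rwa [map_zero] at this
  simpa only [add_zero] using tendsto_const_nhds.add h1

end Perturbation

/-! ### Uniform convergence for slowly varying functions -/

section SlowVariation

/-- The uniform convergence theorem, in additive form. -/
theorem uniform_of_tendsto_add_sub {h : ℝ → ℝ} (hm : Measurable h)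
    (hlim : ∀ u : ℝ, Tendsto (fun x => h (x + u) - h x) atTop (𝓝 0)) {ε : ℝ} (hε : 0 < ε) :
    ∀ᶠ x in atTop, ∀ u ∈ Icc (0 : ℝ) 1, |h (x + u) - h x| < ε := by
  -- Capping the increment at 1 lets dominated convergence apply with no prior local bound on h.
  set D : ℝ → ℝ → ℝ := fun x y => min 1 |h y - h x| with hD
  have hD0 : ∀ x y, 0 ≤ D x y := fun x y => le_min zero_le_one (abs_nonneg _)
  have hD1 : ∀ x y, D x y ≤ 1 := fun x y => min_le_left _ _
  have hDm : ∀ x c : ℝ, Measurable fun y : ℝ => D x (c + y) := fun x c => by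
    have : Measurable fun y : ℝ => h (c + y) := hm.comp (measurable_const_add c)
    exact measurable_const.min (this.sub_const _).abs
  have hDi : ∀ x c a b : ℝ, IntervalIntegrable (fun y : ℝ => D x (c + y)) volume a b := by
    intro x c a b
    refine (intervalIntegrable_const (c := (1 : ℝ))).mono_fun (hDm x c).aestronglyMeasurable
      (Eventually.of_forall fun y => ?_)
    beta_reduce
    rw [Real.norm_of_nonneg (hD0 _ _), norm_one]
    exact hD1 _ _
  set Φ : ℝ → ℝ := fun x => ∫ y in (0 : ℝ)..2, D x (x + y) with hΦ
  have hΦ0 : Tendsto Φ atTop (𝓝 0) := by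
    have := intervalIntegral.tendsto_integral_filter_of_dominated_convergence
      (μ := volume) (a := 0) (b := 2) (l := atTop) (F := fun x y => D x (x + y))
      (f := fun _ => (0 : ℝ)) (fun _ => (1 : ℝ))
      (Eventually.of_forall fun x => (hDm x x).aestronglyMeasurable)
      (Eventually.of_forall fun x => Eventually.of_forall fun y _ => by
        rw [Real.norm_of_nonneg (hD0 _ _)]; exact hD1 _ _)
      intervalIntegrable_const
      (Eventually.of_forall fun y _ => by
        have h1 : Tendsto (fun x => min 1 |h (x + y) - h x|) atTop (𝓝 (min 1 |(0 : ℝ)|)) :=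
          tendsto_const_nhds.min (hlim y).abs
        simpa using h1)
    rwa [intervalIntegral.integral_zero] at this
  have hε' : 0 < min ε 1 / 2 := by positivity
  obtain ⟨X, hX⟩ := eventually_atTop.1 (hΦ0.eventually_lt_const hε')
  filter_upwards [eventually_ge_atTop X] with x hx u hu
  -- For u in [0, 1] the windows [x, x + 2] and [x + u, x + u + 2] share [x + 1, x + 2]; averaging
  -- the triangle inequality through a point of this unit interval bounds the increment by the two
  -- means.
  have key : D x (x + u) ≤ Φ x + Φ (x + u) := by
    have h1 : ∫ _ in (1 : ℝ)..2, D x (x + u) = D x (x + u) := by norm_num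
    have h2 : ∫ y in (1 : ℝ)..2, D x (x + y) ≤ Φ x :=
      intervalIntegral.integral_mono_interval zero_le_one one_le_two le_rfl
        (Eventually.of_forall fun y => hD0 _ _) (hDi x x 0 2)
    have h3 : ∫ y in (1 : ℝ)..2, D (x + u) (x + y) ≤ Φ (x + u) := by
      have h4 : ∫ y in (1 : ℝ)..2, D (x + u) (x + y)
          = ∫ y in (1 - u)..(2 - u), D (x + u) (x + u + y) := by
        rw [← intervalIntegral.integral_comp_sub_right (fun y => D (x + u) (x + u + y)) u]
        congr 1; ext y; congr 1; ring
      rw [h4]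
      exact intervalIntegral.integral_mono_interval (by linarith [hu.2]) (by linarith)
        (by linarith [hu.1]) (Eventually.of_forall fun y => hD0 _ _) (hDi _ _ 0 2)
    rw [← h1]
    refine le_trans ?_ (add_le_add h2 h3)
    rw [← intervalIntegral.integral_add (hDi _ _ _ _) (hDi _ _ _ _)]
    refine intervalIntegral.integral_mono_on one_le_two intervalIntegrable_const
      ((hDi _ _ _ _).add (hDi _ _ _ _)) fun y _ => ?_
    have h5 : |h (x + u) - h x| ≤ |h (x + y) - h x| + |h (x + y) - h (x + u)| := by
      rw [abs_sub_comm (h (x + y)) (h (x + u))]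
      linarith [abs_sub_le (h (x + u)) (h (x + y)) (h x)]
    simp only [hD]
    rcases le_total 1 |h (x + y) - h x| with h6 | h6
    · rw [min_eq_left h6]
      exact (min_le_left _ _).trans (le_add_of_nonneg_right (hD0 (x + u) (x + y)))
    · rcases le_total 1 |h (x + y) - h (x + u)| with h7 | h7
      · rw [min_eq_left h7]
        exact (min_le_left _ _).trans (le_add_of_nonneg_left (hD0 x (x + y)))
      · rw [min_eq_right h6, min_eq_right h7]
        exact (min_le_right _ _).trans h5
  have h1 := hX x hx
  have h2 := hX (x + u) (by linarith [hu.1])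
  have h3 : D x (x + u) < min ε 1 := by linarith
  simp only [hD] at h3
  rcases min_lt_iff.1 h3 with h4 | h4
  · exact absurd (h4.trans_le (min_le_right _ _)) (lt_irrefl _)
  · exact h4.trans_le (min_le_left _ _)

/-- The tail is prescribed at integers only, hence the need to compare ℓ at x and at its integer
part. The ratio x/⌊x⌋ varies with x, so the pointwise definition does not suffice; it stays in a
compact range, and uniform convergence in logarithmic coordinates applies. -/
theorem IsSlowlyVarying.tendsto_floor {ℓ : ℝ → ℝ} (hℓ : IsSlowlyVarying ℓ) :
    Tendsto (fun x : ℝ => ℓ ⌊x⌋₊ / ℓ x) atTop (𝓝 1) := by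
  obtain ⟨hm, hpos, hlim⟩ := hℓ
  set h : ℝ → ℝ := fun x => Real.log (ℓ (Real.exp x)) with hh
  have hmh : Measurable h := Real.measurable_log.comp (hm.comp Real.measurable_exp)
  have hpe : ∀ᶠ x : ℝ in atTop, 0 < ℓ (Real.exp x) := Real.tendsto_exp_atTop.eventually hpos
  have hlimh : ∀ u : ℝ, Tendsto (fun x => h (x + u) - h x) atTop (𝓝 0) := by
    intro u
    have h1 := ((hlim (Real.exp u) (Real.exp_pos u)).comp Real.tendsto_exp_atTop).log one_ne_zero
    rw [Real.log_one] at h1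
    refine h1.congr' ?_
    filter_upwards [hpe, (tendsto_atTop_add_const_right _ u tendsto_id).eventually hpe] with x h2 h3
    simp only [id] at h3
    have h4 : Real.exp u * Real.exp x = Real.exp (x + u) := by rw [← Real.exp_add, add_comm]
    simp only [Function.comp_apply, h4, hh]
    rw [Real.log_div h3.ne' h2.ne']
  have hfl : Tendsto (fun x : ℝ => (⌊x⌋₊ : ℝ)) atTop atTop :=
    tendsto_natCast_atTop_atTop.comp tendsto_nat_floor_atTop
  have hlog : Tendsto (fun x : ℝ => Real.log (ℓ ⌊x⌋₊ / ℓ x)) atTop (𝓝 0) := by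
    rw [Metric.tendsto_nhds]
    intro ε hε
    have h1 := (Real.tendsto_log_atTop.comp hfl).eventually
      (uniform_of_tendsto_add_sub hmh hlimh hε)
    filter_upwards [h1, hpos, hfl.eventually hpos, eventually_ge_atTop 1] with x h2 h3 h4 hx
    have hn : (1 : ℝ) ≤ (⌊x⌋₊ : ℝ) := by exact_mod_cast Nat.one_le_floor_iff _ |>.2 hx
    have hle : (⌊x⌋₊ : ℝ) ≤ x := Nat.floor_le (by linarith)
    have hlt : x < ⌊x⌋₊ + 1 := Nat.lt_floor_add_one x
    -- The displacement lies in [0, 1] because x/⌊x⌋ ≤ 2 ≤ e.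
    have h5 := h2 (Real.log x - Real.log ⌊x⌋₊) ⟨sub_nonneg.2 (Real.log_le_log (by linarith) hle), by
      rw [← Real.log_div (by linarith) (by linarith), Real.log_le_iff_le_exp (by positivity)]
      have : x / ⌊x⌋₊ ≤ 2 := by rw [div_le_iff₀ (by linarith)]; linarith
      linarith [Real.add_one_le_exp (1 : ℝ)]⟩
    simp only [Function.comp_apply, add_sub_cancel, hh, Real.exp_log (show 0 < x by linarith),
      Real.exp_log (show (0 : ℝ) < ⌊x⌋₊ by linarith)] at h5
    rw [Real.dist_eq, sub_zero, Real.log_div h4.ne' h3.ne', abs_sub_comm]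
    exact h5
  have := (Real.continuous_exp.tendsto 0).comp hlog
  rw [Real.exp_zero] at this
  refine this.congr' ?_
  filter_upwards [hpos, hfl.eventually hpos] with x h3 h4
  rw [Function.comp_apply, Real.exp_log (div_pos h4 h3)]

end SlowVariation

/-! ### Regularly varying monotone tails and a Potter bound -/

section RegularTail

variable {T : ℝ → ℝ} {ℓ : ℝ → ℝ} {β : ℝ}

/-- If `T` is constant on the intervals `[n, n + 1)` and regularly varying along the integers,
then it is regularly varying. -/
theorem IsSlowlyVarying.tendsto_tail_div (hℓ : IsSlowlyVarying ℓ)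
    (hfloor : ∀ x, 0 ≤ x → T x = T ⌊x⌋₊)
    (htail : ∀ n : ℕ, 1 ≤ n → T n = ℓ n * (n : ℝ) ^ (-β)) :
    Tendsto (fun x => T x / (ℓ x * x ^ (-β))) atTop (𝓝 1) := by
  have h1 := hℓ.tendsto_floor
  have h2 : Tendsto (fun x : ℝ => ((⌊x⌋₊ : ℝ) / x) ^ (-β)) atTop (𝓝 1) := by
    have := (tendsto_nat_floor_div_atTop (R := ℝ)).rpow_const (p := -β) (Or.inl one_ne_zero)
    rwa [Real.one_rpow] at this
  have h3 := h1.mul h2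
  rw [one_mul] at h3
  refine h3.congr' ?_
  filter_upwards [eventually_ge_atTop 1] with x hx
  have hn : 1 ≤ ⌊x⌋₊ := Nat.one_le_floor_iff _ |>.2 hx
  rw [hfloor x (by linarith), htail _ hn, Real.div_rpow (Nat.cast_nonneg _) (by linarith),
    div_mul_div_comm]

theorem tail_pos (hanti : Antitone T) (hev : ∀ᶠ x in atTop, 0 < T x) (x : ℝ) : 0 < T x := by
  obtain ⟨y, hy, hxy⟩ := (hev.and (eventually_ge_atTop x)).exists
  exact hy.trans_le (hanti hxy)

theorem IsSlowlyVarying.eventually_tail_pos (hℓ : IsSlowlyVarying ℓ)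
    (hT : Tendsto (fun x => T x / (ℓ x * x ^ (-β))) atTop (𝓝 1)) : ∀ᶠ x in atTop, 0 < T x := by
  filter_upwards [hT.eventually_const_lt one_half_lt_one, hℓ.2.1, eventually_gt_atTop 0]
    with x h1 h2 h3
  have h4 : 0 < ℓ x * x ^ (-β) := mul_pos h2 (Real.rpow_pos_of_pos h3 _)
  rw [lt_div_iff₀ h4] at h1
  linarith

theorem IsSlowlyVarying.tendsto_tail_ratio (hℓ : IsSlowlyVarying ℓ)
    (hT : Tendsto (fun x => T x / (ℓ x * x ^ (-β))) atTop (𝓝 1)) {y : ℝ} (hy : 0 < y) :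
    Tendsto (fun t => T (t * y) / T t) atTop (𝓝 (y ^ (-β))) := by
  have hmul : Tendsto (fun t : ℝ => t * y) atTop atTop := tendsto_id.atTop_mul_const hy
  have h1 := (((hT.comp hmul).div hT one_ne_zero).mul (hℓ.2.2 y hy)).mul
    (tendsto_const_nhds (x := y ^ (-β)))
  rw [div_one, one_mul, one_mul] at h1
  refine h1.congr' ?_
  filter_upwards [hℓ.2.1, hmul.eventually hℓ.2.1, eventually_gt_atTop 0,
    hℓ.eventually_tail_pos hT] with t h2 h3 h4 h5
  have h6 := Real.rpow_pos_of_pos h4 (-β)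
  have h7 := Real.rpow_pos_of_pos hy (-β)
  simp only [Function.comp_apply, Pi.div_apply]
  rw [mul_comm y t, Real.mul_rpow h4.le hy.le]
  field_simp

/-- A Potter bound for monotone regularly varying functions. -/
theorem IsSlowlyVarying.exists_tail_le (hℓ : IsSlowlyVarying ℓ) (hanti : Antitone T)
    (hT : Tendsto (fun x => T x / (ℓ x * x ^ (-β))) atTop (𝓝 1)) {κ : ℝ} (hκ0 : 0 < κ)
    (hκ : β < κ) :
    ∃ C : ℝ, 1 ≤ C ∧ ∀ᶠ t in atTop, ∀ y ∈ Ioc (0 : ℝ) 1, T (t * y) ≤ C * y ^ (-κ) * T t := by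
  have hpos := tail_pos hanti (hℓ.eventually_tail_pos hT)
  set U : ℝ → ℝ := fun x => x ^ κ * T x with hU
  have hUpos : ∀ x, 0 < x → 0 < U x := fun x hx => mul_pos (Real.rpow_pos_of_pos hx _) (hpos x)
  -- U is regularly varying of index κ - β > 0, so halving a large argument does not increase it.
  have h1 : ∀ᶠ t in atTop, U (t / 2) ≤ U t := by
    have h2 := hℓ.tendsto_tail_ratio hT (y := 1 / 2) (by norm_num)
    have h3 : ((1 : ℝ) / 2) ^ (-β) < (1 / 2) ^ (-κ) :=
      Real.rpow_lt_rpow_of_exponent_gt (by norm_num) (by norm_num) (by linarith)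
    filter_upwards [h2.eventually_lt_const h3, eventually_gt_atTop 0] with t h4 ht
    rw [div_lt_iff₀ (hpos t), ← div_eq_mul_one_div] at h4
    simp only [hU]
    calc (t / 2) ^ κ * T (t / 2) ≤ (t / 2) ^ κ * ((1 / 2) ^ (-κ) * T t) := by gcongr
      _ = t ^ κ * T t := by
        rw [div_eq_mul_one_div t 2, Real.mul_rpow ht.le (by norm_num), mul_assoc, ← mul_assoc _ _ (T t),
          ← Real.rpow_add (by norm_num), add_neg_cancel, Real.rpow_zero, one_mul]
  obtain ⟨t₁, ht₁⟩ := eventually_atTop.1 h1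
  set t₀ := max t₁ 1 with ht₀
  have ht₀1 : 1 ≤ t₀ := le_max_right _ _
  -- Only the starting point of each halving has to be at least t₀, so the last one may end at t₀/2;
  -- this explains the factor 2.
  have hiter : ∀ k : ℕ, ∀ t, t₀ * 2 ^ k ≤ 2 * t → t₀ ≤ t → U (t / 2 ^ k) ≤ U t := by
    intro k
    induction k with
    | zero => intro t _ _; simp
    | succ k ih =>
      intro t ht htt
      have h2 : t₀ ≤ t / 2 ^ k := by
        rw [le_div_iff₀ (by positivity)]
        rw [pow_succ] at ht; linarith
      have h3 := ht₁ (t / 2 ^ k) ((le_max_left _ _).trans h2)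
      rw [div_div, ← pow_succ] at h3
      refine h3.trans (ih t ?_ htt)
      rw [le_div_iff₀ (by positivity)] at h2
      linarith
  -- Round x down to a dyadic fraction of t: monotonicity of T and a factor 2^κ cover the gap
  -- between consecutive dyadic points.
  have hmid : ∀ x t, t₀ ≤ x → x ≤ t → U x ≤ 2 ^ κ * U t := by
    intro x t hx hxt
    have hx0 : 0 < x := by linarith
    obtain ⟨k, hk1, hk2⟩ := exists_nat_pow_near (one_le_div hx0 |>.2 hxt) one_lt_two
    rw [le_div_iff₀ hx0] at hk1
    rw [div_lt_iff₀ hx0] at hk2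
    have h2 : U (t / 2 ^ (k + 1)) ≤ U t := by
      refine hiter (k + 1) t ?_ (hx.trans hxt)
      rw [pow_succ]
      have : t₀ * 2 ^ k ≤ 2 ^ k * x := by rw [mul_comm]; gcongr
      linarith
    have h3 : t / 2 ^ (k + 1) ≤ x := by rw [div_le_iff₀ (by positivity)]; linarith
    have h4 : x ≤ 2 * (t / 2 ^ (k + 1)) := by
      rw [pow_succ, mul_comm (2 ^ k) (2 : ℝ), ← div_div, mul_div_assoc', mul_div_assoc',
        le_div_iff₀ (by positivity)]
      linarith
    have h5 : 0 < t / 2 ^ (k + 1) := by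
      have : 0 < t := by linarith
      positivity
    calc U x = x ^ κ * T x := rfl
      _ ≤ (2 * (t / 2 ^ (k + 1))) ^ κ * T (t / 2 ^ (k + 1)) := by
        have := hpos x
        exact mul_le_mul (Real.rpow_le_rpow hx0.le h4 hκ0.le) (hanti h3) this.le (by positivity)
      _ = 2 ^ κ * U (t / 2 ^ (k + 1)) := by
        rw [Real.mul_rpow (by norm_num) h5.le, mul_assoc]
      _ ≤ 2 ^ κ * U t := by gcongr
  -- The second entry is for t y ≤ t₀, where U(t y) ≤ t₀^κ T(0), while U(t) is at least 2^{-κ}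
  -- U(t₀).
  set C := max (2 ^ κ) (2 ^ κ * (t₀ ^ κ * T 0) / U t₀) with hC
  have hone : (1 : ℝ) ≤ 2 ^ κ := Real.one_le_rpow one_le_two hκ0.le
  refine ⟨C, hone.trans (le_max_left _ _), ?_⟩
  filter_upwards [eventually_ge_atTop t₀] with t ht y hy
  have ht0 : 0 < t := by linarith
  have hty : 0 < t * y := mul_pos ht0 hy.1
  have hUC : U (t * y) ≤ C * U t := by
    rcases le_total t₀ (t * y) with h2 | h2
    · refine (hmid _ _ h2 (mul_le_of_le_one_right ht0.le hy.2)).trans ?_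
      exact mul_le_mul_of_nonneg_right (le_max_left _ _) (hUpos t ht0).le
    · have h3 := hmid t₀ t le_rfl ht
      have h4 := hUpos t₀ (by linarith)
      calc U (t * y) ≤ t₀ ^ κ * T 0 :=
            mul_le_mul (Real.rpow_le_rpow hty.le h2 hκ0.le) (hanti hty.le) (hpos _).le (by positivity)
        _ = (t₀ ^ κ * T 0 / U t₀) * U t₀ := by field_simp
        _ ≤ (t₀ ^ κ * T 0 / U t₀) * (2 ^ κ * U t) := by
          have := hpos 0
          gcongr
        _ = (2 ^ κ * (t₀ ^ κ * T 0) / U t₀) * U t := by ring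
        _ ≤ C * U t := mul_le_mul_of_nonneg_right (le_max_right _ _) (hUpos t ht0).le
  simp only [hU] at hUC
  rw [Real.mul_rpow ht0.le hy.1.le] at hUC
  have h6 := Real.rpow_pos_of_pos ht0 κ
  have h7 := Real.rpow_pos_of_pos hy.1 κ
  rw [Real.rpow_neg hy.1.le, ← div_eq_mul_inv, div_mul_eq_mul_div, le_div_iff₀ h7]
  refine le_of_mul_le_mul_left ?_ h6
  linarith

end RegularTail

/-! ### The Laplace transform of a power in the closed half plane -/

section LaplacePower

variable {β : ℝ}

theorem integrableOn_rpow_mul_exp_neg (hβ1 : β < 1) {t : ℝ} (ht : 0 < t) :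
    IntegrableOn (fun y : ℝ => y ^ (-β) * Real.exp (-t * y)) (Ioi 0) := by
  simpa using integrableOn_rpow_mul_exp_neg_mul_rpow (s := -β) (p := 1) (by linarith) one_pos ht

/-- The Laplace transform of a power function, in the open right half plane. -/
theorem integral_cexp_neg_mul_rpow_Ioi (hβ1 : β < 1) {s : ℂ} (hs : 0 < s.re) :
    ∫ y in Ioi (0 : ℝ), Complex.exp (-(s * y)) * ((y ^ (-β) : ℝ) : ℂ)
      = (Real.Gamma (1 - β) : ℂ) * s ^ ((β - 1 : ℝ) : ℂ) := by
  have hmeas : Measurable fun y : ℝ => (y ^ (-β)).toNNReal :=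
    (measurable_id.pow_const (-β)).real_toNNReal
  -- Seen as the complex moment generating function of -y under y^{-β} dy, the left side is analytic
  -- for Re s > 0. It agrees with the right side on the positive axis by the Gamma integral, hence
  -- everywhere by the identity theorem.
  set μ : Measure ℝ := (volume.restrict (Ioi 0)).withDensity
    (fun y => ((y ^ (-β)).toNNReal : ℝ≥0∞)) with hμ
  have hMGF : ∀ z : ℂ, ProbabilityTheory.complexMGF (fun y : ℝ => -y) μ z
      = ∫ y in Ioi (0 : ℝ), Complex.exp (-(z * y)) * ((y ^ (-β) : ℝ) : ℂ) := by
    intro z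
    rw [ProbabilityTheory.complexMGF, hμ, integral_withDensity_eq_integral_smul hmeas]
    refine setIntegral_congr_fun measurableSet_Ioi fun y hy => ?_
    have : 0 ≤ y ^ (-β) := Real.rpow_nonneg (le_of_lt hy) _
    simp only [NNReal.smul_def, Real.coe_toNNReal _ this, Complex.real_smul]
    push_cast
    rw [mul_neg, mul_comm]
  have hexp : Ioi 0 ⊆ ProbabilityTheory.integrableExpSet (fun y : ℝ => -y) μ := by
    intro t ht
    rw [ProbabilityTheory.integrableExpSet, mem_ofPred_eq, hμ,
      integrable_withDensity_iff_integrable_smul hmeas]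
    refine (integrableOn_rpow_mul_exp_neg hβ1 ht).congr_fun (fun y hy => ?_) measurableSet_Ioi
    have : 0 ≤ y ^ (-β) := Real.rpow_nonneg (le_of_lt hy) _
    simp only [NNReal.smul_def, Real.coe_toNNReal _ this, smul_eq_mul]
    rw [mul_neg, neg_mul]
  have hint : Ioi 0 ⊆ interior (ProbabilityTheory.integrableExpSet (fun y : ℝ => -y) μ) :=
    interior_maximal hexp isOpen_Ioi
  have hconv : IsPreconnected {z : ℂ | 0 < z.re} := (convex_halfSpace_re_gt 0).isPreconnected
  have hf : AnalyticOnNhd ℂ (ProbabilityTheory.complexMGF (fun y : ℝ => -y) μ) {z : ℂ | 0 < z.re} :=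
    fun z hz => ProbabilityTheory.analyticAt_complexMGF (hint hz)
  have hg : AnalyticOnNhd ℂ (fun z : ℂ => (Real.Gamma (1 - β) : ℂ) * z ^ ((β - 1 : ℝ) : ℂ))
      {z : ℂ | 0 < z.re} := fun z hz =>
    analyticAt_const.mul (analyticAt_id.cpow analyticAt_const (Or.inl hz))
  have hreal : ∀ t : ℝ, 0 < t → ProbabilityTheory.complexMGF (fun y : ℝ => -y) μ (t : ℂ)
      = (Real.Gamma (1 - β) : ℂ) * (t : ℂ) ^ ((β - 1 : ℝ) : ℂ) := by
    intro t ht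
    rw [hMGF, ← Complex.ofReal_cpow ht.le, ← Complex.ofReal_mul]
    have h1 := Real.integral_rpow_mul_exp_neg_mul_Ioi (a := 1 - β) (by linarith) ht
    have h2 : Real.Gamma (1 - β) * t ^ (β - 1) = (1 / t) ^ (1 - β) * Real.Gamma (1 - β) := by
      rw [one_div, Real.inv_rpow ht.le, ← Real.rpow_neg ht.le, neg_sub, mul_comm]
    rw [h2, ← h1, ← integral_complex_ofReal]
    refine setIntegral_congr_fun measurableSet_Ioi fun y hy => ?_
    rw [sub_sub_cancel_left]
    push_cast
    rw [mul_comm]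
  have hfreq : ∃ᶠ z in 𝓝[≠] (1 : ℂ), ProbabilityTheory.complexMGF (fun y : ℝ => -y) μ z
      = (Real.Gamma (1 - β) : ℂ) * z ^ ((β - 1 : ℝ) : ℂ) := by
    have h1 : Tendsto (fun t : ℝ => (t : ℂ)) (𝓝[≠] (1 : ℝ)) (𝓝[≠] (1 : ℂ)) := by
      refine tendsto_nhdsWithin_iff.2 ⟨?_, ?_⟩
      · have := (Complex.continuous_ofReal.tendsto 1).mono_left
          (nhdsWithin_le_nhds (s := {(1 : ℝ)}ᶜ))
        simpa using this
      · filter_upwards [self_mem_nhdsWithin] with t ht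
        simpa using ht
    refine h1.frequently (Eventually.frequently ?_)
    filter_upwards [nhdsWithin_le_nhds (lt_mem_nhds one_pos)] with t ht using hreal t ht
  rw [← hMGF]
  exact hf.eqOn_of_preconnected_of_frequently_eq hg hconv (by simp) hfreq hs

theorem norm_exp_neg_mul_le_one {s : ℂ} (hs : 0 ≤ s.re) {y : ℝ} (hy : 0 ≤ y) :
    ‖Complex.exp (-(s * y))‖ ≤ 1 := by
  rw [Complex.norm_exp, Real.exp_le_one_iff]
  simp only [Complex.neg_re, Complex.mul_re, Complex.ofReal_re, Complex.ofReal_im, mul_zero,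
    sub_zero, neg_nonpos]
  positivity

theorem norm_mul_exp_neg_mul_le {s : ℂ} (hs : 0 ≤ s.re) {y : ℝ} (hy : 0 ≤ y) :
    ‖s * Complex.exp (-(s * y))‖ ≤ ‖s‖ := by
  rw [norm_mul]
  exact mul_le_of_le_one_right (norm_nonneg _) (norm_exp_neg_mul_le_one hs hy)

theorem hasDerivAt_exp_neg_mul (s : ℂ) (y : ℝ) :
    HasDerivAt (fun y : ℝ => -Complex.exp (-(s * y))) (s * Complex.exp (-(s * y))) y := by
  have h1 : HasDerivAt (fun y : ℝ => -(s * (y : ℂ))) (-(s * 1)) y :=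
    (Complex.ofRealCLM.hasDerivAt.const_mul s).neg
  have := h1.cexp.neg
  rwa [mul_one, mul_neg, neg_neg, mul_comm] at this

/-- Integrate by parts: the antiderivative -e^{-sy} of s e^{-sy} is bounded by 1 and y^{-β} is
decreasing. The bound depends on neither b nor s, so it gives uniform control up to the imaginary
axis, where absolute convergence at infinity fails for β < 1. -/
theorem norm_integral_exp_mul_rpow_le (hβ0 : 0 < β) {s : ℂ} (hs : 0 ≤ s.re) {a b : ℝ} (ha : 0 < a)
    (hab : a ≤ b) :
    ‖∫ y in a..b, s * Complex.exp (-(s * y)) * ((y ^ (-β) : ℝ) : ℂ)‖ ≤ 2 * a ^ (-β) := by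
  have hpos : ∀ y ∈ uIcc a b, 0 < y := fun y hy => by
    rw [uIcc_of_le hab] at hy; exact ha.trans_le hy.1
  have hd : ∀ y ∈ uIcc a b, HasDerivAt (fun y : ℝ => ((y ^ (-β) : ℝ) : ℂ))
      ((-β * y ^ (-β - 1) : ℝ) : ℂ) y := fun y hy =>
    (Real.hasDerivAt_rpow_const (Or.inl (hpos y hy).ne')).ofReal_comp
  have hcont : ContinuousOn (fun y : ℝ => -β * y ^ (-β - 1)) (uIcc a b) :=
    continuousOn_const.mul (continuousOn_id.rpow_const fun y hy => Or.inl (hpos y hy).ne')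
  have hint' : IntervalIntegrable (fun y : ℝ => -β * y ^ (-β - 1)) volume a b :=
    hcont.intervalIntegrable
  have hibp := intervalIntegral.integral_deriv_mul_eq_sub
    (u := fun y : ℝ => -Complex.exp (-(s * y))) (v := fun y : ℝ => ((y ^ (-β) : ℝ) : ℂ))
    (fun y _ => hasDerivAt_exp_neg_mul s y) hd
    (Continuous.intervalIntegrable (by fun_prop) a b)
    ((Complex.continuous_ofReal.comp_continuousOn hcont).intervalIntegrable)
  have hi1 : IntervalIntegrable (fun y : ℝ => s * Complex.exp (-(s * y)) * ((y ^ (-β) : ℝ) : ℂ))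
      volume a b := by
    refine ContinuousOn.intervalIntegrable (ContinuousOn.mul (by fun_prop) ?_)
    exact Complex.continuous_ofReal.comp_continuousOn
      (continuousOn_id.rpow_const fun y hy => Or.inl (hpos y hy).ne')
  have hi2 : IntervalIntegrable (fun y : ℝ => -Complex.exp (-(s * y)) *
      ((-β * y ^ (-β - 1) : ℝ) : ℂ)) volume a b :=
    ContinuousOn.intervalIntegrable
      (ContinuousOn.mul (by fun_prop) (Complex.continuous_ofReal.comp_continuousOn hcont))
  rw [intervalIntegral.integral_add hi1 hi2] at hibp
  rw [eq_sub_of_add_eq hibp]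
  have hval : ∫ y in a..b, -β * y ^ (-β - 1) = b ^ (-β) - a ^ (-β) :=
    intervalIntegral.integral_eq_sub_of_hasDerivAt
      (fun y hy => Real.hasDerivAt_rpow_const (Or.inl (hpos y hy).ne')) hint'
  have h3 : ‖∫ y in a..b, -Complex.exp (-(s * y)) * ((-β * y ^ (-β - 1) : ℝ) : ℂ)‖
      ≤ a ^ (-β) - b ^ (-β) := by
    rw [← neg_sub (b ^ (-β)) (a ^ (-β)), ← hval, ← intervalIntegral.integral_neg]
    refine intervalIntegral.norm_integral_le_of_norm_le hab (Eventually.of_forall fun y hy => ?_)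
      hint'.neg
    have hy0 : 0 < y := ha.trans hy.1
    rw [norm_mul, norm_neg, Complex.norm_real, Real.norm_eq_abs, abs_mul, abs_neg,
      abs_of_pos hβ0, abs_of_pos (Real.rpow_pos_of_pos hy0 _)]
    have := mul_le_of_le_one_left (mul_nonneg hβ0.le (Real.rpow_nonneg hy0.le (-β - 1)))
      (norm_exp_neg_mul_le_one hs hy0.le)
    linarith
  have hb : 0 < b := ha.trans_le hab
  have h4 : ∀ y : ℝ, 0 < y → ‖-Complex.exp (-(s * y)) * ((y ^ (-β) : ℝ) : ℂ)‖ ≤ y ^ (-β) := by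
    intro y hy
    rw [norm_mul, norm_neg, Complex.norm_real, Real.norm_of_nonneg (Real.rpow_nonneg hy.le _)]
    exact mul_le_of_le_one_left (Real.rpow_nonneg hy.le _) (norm_exp_neg_mul_le_one hs hy.le)
  calc _ ≤ ‖-Complex.exp (-(s * b)) * ((b ^ (-β) : ℝ) : ℂ)
          - -Complex.exp (-(s * a)) * ((a ^ (-β) : ℝ) : ℂ)‖ + (a ^ (-β) - b ^ (-β)) :=
        (norm_sub_le _ _).trans (add_le_add_right h3 _)
    _ ≤ (b ^ (-β) + a ^ (-β)) + (a ^ (-β) - b ^ (-β)) := by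
        gcongr
        exact (norm_sub_le _ _).trans (add_le_add (h4 b hb) (h4 a ha))
    _ = _ := by ring

theorem aestronglyMeasurable_kernel (s : ℂ) {u : ℝ → ℝ} (hu : Measurable u) (ν : Measure ℝ) :
    AEStronglyMeasurable (fun y : ℝ => s * Complex.exp (-(s * y)) * ((u y : ℝ) : ℂ)) ν := by
  have h1 : Measurable fun y : ℝ => s * Complex.exp (-(s * y)) := by fun_prop
  exact (h1.mul (Complex.measurable_ofReal.comp hu)).aestronglyMeasurable

/-- The truncated integrals converge to `Γ(1 - β) s ^ β`, uniformly in the closed half plane. -/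
theorem norm_truncated_sub_le (hβ0 : 0 < β) (hβ1 : β < 1) {s : ℂ} (hs : 0 ≤ s.re) (hs0 : s ≠ 0)
    {K : ℝ} (hK : 0 < K) :
    ‖(∫ y in (0 : ℝ)..K, s * Complex.exp (-(s * y)) * ((y ^ (-β) : ℝ) : ℂ))
      - (Real.Gamma (1 - β) : ℂ) * s ^ (β : ℂ)‖ ≤ 2 * K ^ (-β) := by
  have hmeas : Measurable fun y : ℝ => y ^ (-β) := measurable_id.pow_const (-β)
  have hrp : ∀ a b : ℝ, IntervalIntegrable (fun y : ℝ => y ^ (-β)) volume a b := fun a b =>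
    intervalIntegral.intervalIntegrable_rpow' (by linarith)
  -- Inside the half plane the difference is the integral beyond K, a limit of integrals already
  -- bounded by 2K^{-β}. Boundary points are reached as limits of s + ε.
  have hopen : ∀ {s : ℂ}, 0 < s.re →
      ‖(∫ y in (0 : ℝ)..K, s * Complex.exp (-(s * y)) * ((y ^ (-β) : ℝ) : ℂ))
        - (Real.Gamma (1 - β) : ℂ) * s ^ (β : ℂ)‖ ≤ 2 * K ^ (-β) := by
    intro s hs
    have hs0 : s ≠ 0 := fun h => by simp [h] at hs
    have hI : IntegrableOn (fun y : ℝ => s * Complex.exp (-(s * y)) * ((y ^ (-β) : ℝ) : ℂ))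
        (Ioi 0) := by
      refine ((integrableOn_rpow_mul_exp_neg hβ1 hs).const_mul ‖s‖).mono'
        (aestronglyMeasurable_kernel s hmeas _) ?_
      refine (ae_restrict_mem measurableSet_Ioi).mono fun y hy => le_of_eq ?_
      rw [norm_mul, norm_mul, Complex.norm_real, Complex.norm_exp,
        Real.norm_of_nonneg (Real.rpow_nonneg (le_of_lt hy) _)]
      simp only [Complex.neg_re, Complex.mul_re, Complex.ofReal_re, Complex.ofReal_im, mul_zero,
        sub_zero]
      rw [← neg_mul]; ring
    have h1 : ∫ y in Ioi (0 : ℝ), s * Complex.exp (-(s * y)) * ((y ^ (-β) : ℝ) : ℂ)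
        = (Real.Gamma (1 - β) : ℂ) * s ^ (β : ℂ) := by
      simp_rw [mul_assoc]
      rw [integral_const_mul, integral_cexp_neg_mul_rpow_Ioi hβ1 hs, mul_left_comm]
      congr 1
      conv_lhs => rw [← Complex.cpow_one s]
      rw [Complex.cpow_one, Complex.ofReal_sub, Complex.ofReal_one, Complex.cpow_sub _ _ hs0,
        Complex.cpow_one, mul_div_cancel₀ _ hs0]
    have h2 := intervalIntegral_tendsto_integral_Ioi 0 hI tendsto_id
    rw [h1] at h2
    have h3 := ((tendsto_const_nhds (x := ∫ y in (0 : ℝ)..K, s * Complex.exp (-(s * y)) *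
      ((y ^ (-β) : ℝ) : ℂ))).sub h2).norm
    refine le_of_tendsto h3 ?_
    filter_upwards [eventually_ge_atTop K] with b hb
    have hii : ∀ a b : ℝ, 0 ≤ a → a ≤ b → IntervalIntegrable
        (fun y : ℝ => s * Complex.exp (-(s * y)) * ((y ^ (-β) : ℝ) : ℂ)) volume a b := by
      intro a b ha hab
      rw [intervalIntegrable_iff_integrableOn_Ioc_of_le hab]
      exact hI.mono_set fun y hy => ha.trans_lt hy.1
    rw [id, norm_sub_rev, intervalIntegral.integral_interval_sub_left
      (hii 0 b le_rfl (hK.le.trans hb)) (hii 0 K le_rfl hK.le)]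
    exact norm_integral_exp_mul_rpow_le hβ0 hs.le hK hb
  rcases hs.lt_or_eq with h | h
  · exact hopen h
  -- A nonzero imaginary part keeps s off the branch cut, so the power is continuous there.
  have him : s.im ≠ 0 := fun h' => hs0 (Complex.ext h.symm h')
  have hshift : Tendsto (fun ε : ℝ => s + ε) (𝓝[>] 0) (𝓝 s) := by
    have : Tendsto (fun ε : ℝ => s + (ε : ℂ)) (𝓝 0) (𝓝 (s + (0 : ℝ))) :=
      (continuous_const.add Complex.continuous_ofReal).tendsto 0
    rw [Complex.ofReal_zero, add_zero] at this
    exact this.mono_left nhdsWithin_le_nhds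
  have hlim1 : Tendsto (fun ε : ℝ => ∫ y in (0 : ℝ)..K, (s + ε) * Complex.exp (-((s + ε) * y)) *
      ((y ^ (-β) : ℝ) : ℂ)) (𝓝[>] 0)
      (𝓝 (∫ y in (0 : ℝ)..K, s * Complex.exp (-(s * y)) * ((y ^ (-β) : ℝ) : ℂ))) := by
    refine intervalIntegral.tendsto_integral_filter_of_dominated_convergence
      (fun y => (‖s‖ + 1) * y ^ (-β))
      (Eventually.of_forall fun ε => aestronglyMeasurable_kernel _ hmeas _) ?_
      ((hrp 0 K).const_mul _) (Eventually.of_forall fun y _ => ?_)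
    · filter_upwards [self_mem_nhdsWithin,
        nhdsWithin_le_nhds (gt_mem_nhds (zero_lt_one' ℝ))] with ε hε hε1
      refine Eventually.of_forall fun y hy => ?_
      rw [uIoc_of_le hK.le] at hy
      rw [norm_mul, Complex.norm_real, Real.norm_of_nonneg (Real.rpow_nonneg hy.1.le _)]
      refine mul_le_mul_of_nonneg_right ?_ (Real.rpow_nonneg hy.1.le _)
      refine (norm_mul_exp_neg_mul_le (by
        rw [Complex.add_re, Complex.ofReal_re, ← h, zero_add]; exact le_of_lt hε) hy.1.le).trans ?_
      refine (norm_add_le _ _).trans (add_le_add_right ?_ _)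
      rw [Complex.norm_real, Real.norm_of_nonneg (le_of_lt hε)]
      exact hε1.le
    · have : Continuous fun z : ℂ => z * Complex.exp (-(z * y)) * ((y ^ (-β) : ℝ) : ℂ) := by
        fun_prop
      exact (this.tendsto s).comp hshift
  have hlim2 : Tendsto (fun ε : ℝ => (Real.Gamma (1 - β) : ℂ) * (s + ε) ^ (β : ℂ)) (𝓝[>] 0)
      (𝓝 ((Real.Gamma (1 - β) : ℂ) * s ^ (β : ℂ))) :=
    ((continuousAt_cpow_const (Or.inr him)).tendsto.comp hshift).const_mul _
  refine le_of_tendsto (hlim1.sub hlim2).norm ?_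
  filter_upwards [self_mem_nhdsWithin] with ε hε
  exact hopen (by rw [Complex.add_re, Complex.ofReal_re, ← h, zero_add]; exact hε)

end LaplacePower

/-! ### The Abelian theorem for generating functions of regularly varying tails -/

section Abelian

/-- The tail `∑_{n + 1 > x} q n` of a sequence of masses at the positive integers. -/
def massTail (q : ℕ → ℝ) (x : ℝ) : ℝ := ∑' n : ℕ, if x < n + 1 then q n else 0

variable {q : ℕ → ℝ}

theorem summable_massTail (hq0 : ∀ n, 0 ≤ q n) (hq : Summable q) (x : ℝ) :
    Summable fun n : ℕ => if x < n + 1 then q n else 0 :=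
  hq.of_nonneg_of_le (fun n => by split_ifs <;> simp [hq0]) fun n => by
    split_ifs <;> simp [hq0]

theorem massTail_antitone (hq0 : ∀ n, 0 ≤ q n) (hq : Summable q) : Antitone (massTail q) := by
  intro x y hxy
  refine (summable_massTail hq0 hq y).tsum_le_tsum (fun n => ?_) (summable_massTail hq0 hq x)
  by_cases h : y < n + 1
  · rw [if_pos h, if_pos (hxy.trans_lt h)]
  · rw [if_neg h]; split_ifs <;> simp [hq0]

theorem massTail_eq_floor (q : ℕ → ℝ) {x : ℝ} (hx : 0 ≤ x) : massTail q x = massTail q ⌊x⌋₊ := by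
  unfold massTail
  congr 1; ext n
  have : x < n + 1 ↔ ((⌊x⌋₊ : ℕ) : ℝ) < n + 1 := by
    have h1 : ((n : ℝ) + 1) = ((n + 1 : ℕ) : ℝ) := by push_cast; rfl
    rw [h1, ← Nat.floor_lt hx, Nat.cast_lt]
  simp only [this]

/-- Fubini for integrals against the tail. -/
theorem hasSum_integral_mul_massTail (hq0 : ∀ n, 0 ≤ q n) (hq : Summable q) {k : ℝ → ℂ}
    (hk : Continuous k) {a : ℝ} (ha : 0 ≤ a) :
    HasSum (fun n : ℕ => (q n : ℂ) * ∫ x in (0 : ℝ)..min (n + 1) a, k x)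
      (∫ x in (0 : ℝ)..a, k x * (massTail q x : ℂ)) := by
  set F : ℕ → ℝ → ℂ := fun n => (Iio ((n : ℝ) + 1)).indicator fun x => (q n : ℂ) * k x with hF
  have hkI : IntegrableOn k (Ioc 0 a) := (hk.integrableOn_Icc).mono_set Ioc_subset_Icc_self
  have hFi : ∀ n, Integrable (F n) (volume.restrict (Ioc 0 a)) := fun n =>
    (hkI.const_mul _).indicator measurableSet_Iio
  have hFs : Summable fun n => ∫ x in Ioc 0 a, ‖F n x‖ := by
    refine (hq.mul_right (∫ x in Ioc 0 a, ‖k x‖)).of_nonneg_of_le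
      (fun n => integral_nonneg fun _ => norm_nonneg _) fun n => ?_
    rw [← integral_const_mul]
    refine integral_mono (hFi n).norm (hkI.norm.const_mul _) fun x => ?_
    refine (norm_indicator_le_norm_self _ _).trans ?_
    rw [norm_mul, Complex.norm_real, Real.norm_of_nonneg (hq0 n)]
  have h := hasSum_integral_of_summable_integral_norm hFi hFs
  have e1 : ∀ n : ℕ, (q n : ℂ) * ∫ x in (0 : ℝ)..min (n + 1) a, k x = ∫ x in Ioc 0 a, F n x := by
    intro n
    have h1 : (0 : ℝ) ≤ min ((n : ℝ) + 1) a := le_min (by positivity) ha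
    rw [intervalIntegral.integral_of_le h1, ← integral_const_mul]
    simp only [hF]
    rw [setIntegral_indicator measurableSet_Iio]
    refine setIntegral_congr_set ?_
    have h2 : Ioc (0 : ℝ) (min (n + 1) a) = Ioc 0 a ∩ Iic ((n : ℝ) + 1) := by
      ext x; simp only [mem_Ioc, le_min_iff, mem_inter_iff, mem_Iic]; tauto
    rw [h2]
    exact (ae_eq_refl _).inter Iio_ae_eq_Iic.symm
  have e2 : ∫ x in (0 : ℝ)..a, k x * (massTail q x : ℂ) = ∫ x in Ioc 0 a, ∑' n, F n x := by
    rw [intervalIntegral.integral_of_le ha]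
    refine integral_congr_ae (Eventually.of_forall fun x => ?_)
    simp only [massTail, hF]
    rw [Complex.ofReal_tsum, ← tsum_mul_left]
    congr 1; ext n
    simp only [indicator, mem_Iio]
    split_ifs <;> simp [mul_comm]
  rw [e2, funext e1]
  exact h

theorem integral_mul_exp_neg_mul (s : ℂ) (b : ℝ) :
    ∫ x in (0 : ℝ)..b, s * Complex.exp (-(s * x)) = 1 - Complex.exp (-(s * b)) := by
  rw [intervalIntegral.integral_eq_sub_of_hasDerivAt (fun y _ => hasDerivAt_exp_neg_mul s y)
    (Continuous.intervalIntegrable (by fun_prop) _ _)]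
  simp
  ring

/-- The generating function `∑ q n (1 - e^{-s (n + 1)})`. -/
def massTransform (q : ℕ → ℝ) (s : ℂ) : ℂ :=
  ∑' n : ℕ, (q n : ℂ) * (1 - Complex.exp (-(s * ((n + 1 : ℝ) : ℂ))))

theorem norm_exp_sub_exp_le {s : ℂ} (hs : 0 ≤ s.re) {x y : ℝ} (hx : 0 ≤ x) (hy : 0 ≤ y) :
    ‖Complex.exp (-(s * x)) - Complex.exp (-(s * y))‖ ≤ 2 :=
  (norm_sub_le _ _).trans (by
    linarith [norm_exp_neg_mul_le_one hs hx, norm_exp_neg_mul_le_one hs hy])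

theorem norm_one_sub_exp_le {s : ℂ} (hs : 0 ≤ s.re) {y : ℝ} (hy : 0 ≤ y) :
    ‖1 - Complex.exp (-(s * y))‖ ≤ 2 * min 1 (‖s‖ * y) := by
  have h1 : ‖1 - Complex.exp (-(s * y))‖ ≤ 2 := by
    simpa using norm_exp_sub_exp_le hs le_rfl hy
  rcases le_total 1 (‖s‖ * y) with h | h
  · rwa [min_eq_left h, mul_one]
  · rw [min_eq_right h, norm_sub_rev]
    have h2 : ‖-(s * (y : ℂ))‖ = ‖s‖ * y := by
      rw [norm_neg, norm_mul, Complex.norm_real, Real.norm_of_nonneg hy]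
    rw [← h2] at h ⊢
    exact Complex.norm_exp_sub_one_le h

theorem summable_massTransform (hq0 : ∀ n, 0 ≤ q n) (hq : Summable q) {s : ℂ} (hs : 0 ≤ s.re) :
    Summable fun n : ℕ => q n * ‖1 - Complex.exp (-(s * ((n + 1 : ℝ) : ℂ)))‖ := by
  refine (hq.mul_right 2).of_nonneg_of_le (fun n => mul_nonneg (hq0 n) (norm_nonneg _)) fun n => ?_
  refine mul_le_mul_of_nonneg_left ?_ (hq0 n)
  have h1 := norm_one_sub_exp_le hs (y := (n : ℝ) + 1) (by positivity)
  linarith [min_le_left 1 (‖s‖ * ((n : ℝ) + 1))]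

/-- Truncation of the generating function. -/
theorem norm_massTransform_sub_integral_le (hq0 : ∀ n, 0 ≤ q n) (hq : Summable q) {s : ℂ}
    (hs : 0 ≤ s.re) {a : ℝ} (ha : 0 ≤ a) :
    ‖massTransform q s - ∫ x in (0 : ℝ)..a, s * Complex.exp (-(s * x)) * (massTail q x : ℂ)‖
      ≤ 2 * massTail q a := by
  -- Cutting at a replaces n + 1 by min(n + 1, a) in the exponent. Only terms with n + 1 > a change,
  -- each by at most 2 q_n, so no integral up to infinity is needed.
  have h1 := hasSum_integral_mul_massTail hq0 hq
    (k := fun x : ℝ => s * Complex.exp (-(s * x))) (by fun_prop) ha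
  simp_rw [integral_mul_exp_neg_mul] at h1
  have h2 : HasSum (fun n : ℕ => (q n : ℂ) * (1 - Complex.exp (-(s * ((n + 1 : ℝ) : ℂ)))))
      (massTransform q s) := by
    refine (Summable.of_norm ?_).hasSum
    refine (summable_massTransform hq0 hq hs).congr fun n => ?_
    rw [norm_mul, Complex.norm_real, Real.norm_of_nonneg (hq0 n)]
  have h3 := h2.sub h1
  rw [← h3.tsum_eq, massTail, ← tsum_mul_left]
  refine tsum_of_norm_bounded ((summable_massTail hq0 hq a).mul_left 2).hasSum fun n => ?_
  rw [← mul_sub, sub_sub_sub_cancel_left, norm_mul, Complex.norm_real,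
    Real.norm_of_nonneg (hq0 n)]
  by_cases h : a < n + 1
  · rw [if_pos h, mul_comm (2 : ℝ)]
    exact mul_le_mul_of_nonneg_left
      (norm_exp_sub_exp_le hs (le_min (by positivity) ha) (by positivity)) (hq0 n)
  · rw [if_neg h, min_eq_left (not_lt.1 h)]
    simp

variable {ℓ : ℝ → ℝ} {β : ℝ}

/-- The filter of approach to `0` inside the closed right half plane. -/
def halfPlaneNhds : Filter ℂ := 𝓝[{s : ℂ | 0 ≤ s.re ∧ s ≠ 0}] 0

theorem eventually_halfPlaneNhds : ∀ᶠ s in halfPlaneNhds, 0 ≤ s.re ∧ s ≠ 0 :=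
  self_mem_nhdsWithin

theorem tendsto_one_div_norm : Tendsto (fun s : ℂ => 1 / ‖s‖) halfPlaneNhds atTop := by
  simp_rw [one_div]
  refine tendsto_inv_nhdsGT_zero.comp (tendsto_nhdsWithin_iff.2 ⟨?_, ?_⟩)
  · exact tendsto_norm_zero.mono_left nhdsWithin_le_nhds
  · filter_upwards [eventually_halfPlaneNhds] with s hs using norm_pos_iff.2 hs.2

/-- Regular variation gives the pointwise limit. For domination, the Potter bound serves on (0, 1]
and monotonicity, contributing the constant 1, beyond. -/
theorem tendsto_massTail_integral (hβ0 : 0 < β) (hβ1 : β < 1) (hq0 : ∀ n, 0 ≤ q n) (hq : Summable q)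
    (hℓ : IsSlowlyVarying ℓ)
    (hT : Tendsto (fun x => massTail q x / (ℓ x * x ^ (-β))) atTop (𝓝 1)) {K : ℝ} (hK : 0 < K) :
    Tendsto (fun t => ∫ y in (0 : ℝ)..K, |massTail q (t * y) / massTail q t - y ^ (-β)|) atTop
      (𝓝 0) := by
  have hanti := massTail_antitone hq0 hq
  have hpos := tail_pos hanti (hℓ.eventually_tail_pos hT)
  -- The exponent exceeds β, as the Potter bound requires, and is below 1, so that y^{-κ} is
  -- integrable at 0.
  set κ := (1 + β) / 2 with hκ
  obtain ⟨C, hC1, hC⟩ := hℓ.exists_tail_le hanti hT (κ := κ) (by linarith) (by linarith)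
  have hrp : ∀ c : ℝ, c < 1 → IntervalIntegrable (fun y : ℝ => y ^ (-c)) volume 0 K := fun c hc =>
    intervalIntegral.intervalIntegrable_rpow' (by linarith)
  have := intervalIntegral.tendsto_integral_filter_of_dominated_convergence
    (μ := volume) (a := 0) (b := K) (l := atTop)
    (F := fun t y => |massTail q (t * y) / massTail q t - y ^ (-β)|)
    (f := fun _ => (0 : ℝ)) (fun y => (C * y ^ (-κ) + 1) + y ^ (-β)) ?_ ?_ ?_ ?_
  · rwa [intervalIntegral.integral_zero] at this
  · refine Eventually.of_forall fun t => Measurable.aestronglyMeasurable ?_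
    have h1 : Measurable fun y : ℝ => massTail q (t * y) :=
      hanti.measurable.comp (measurable_const_mul t)
    have h2 : Measurable fun y : ℝ => y ^ (-β) := measurable_id.pow_const (-β)
    exact ((h1.div_const _).sub h2).abs
  · filter_upwards [hC, eventually_gt_atTop 0] with t ht ht0
    refine Eventually.of_forall fun y hy => ?_
    rw [uIoc_of_le hK.le] at hy
    have h1 := Real.rpow_nonneg hy.1.le (-β)
    have h2 := Real.rpow_nonneg hy.1.le (-κ)
    have h3 : 0 ≤ massTail q (t * y) / massTail q t := (div_pos (hpos _) (hpos _)).le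
    have h4 : massTail q (t * y) / massTail q t ≤ C * y ^ (-κ) + 1 := by
      rw [div_le_iff₀ (hpos t)]
      have h5 : 0 ≤ C * y ^ (-κ) := by positivity
      have h6 := hpos t
      rcases le_total y 1 with hy1 | hy1
      · nlinarith [ht y ⟨hy.1, hy1⟩]
      · have h7 : massTail q (t * y) ≤ massTail q t := hanti (le_mul_of_one_le_right ht0.le hy1)
        nlinarith
    rw [Real.norm_eq_abs, abs_abs, abs_le]
    constructor <;> linarith
  · exact (((hrp κ (by linarith)).const_mul C).add intervalIntegrable_const).add (hrp β hβ1)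
  · refine Eventually.of_forall fun y hy => ?_
    rw [uIoc_of_le hK.le] at hy
    have h1 := ((hℓ.tendsto_tail_ratio hT hy.1).sub_const (y ^ (-β))).abs
    rwa [sub_self, abs_zero] at h1

/-- Rescaling by t = 1/|s| turns s into a point σ of the unit half circle. Three errors remain: the
cut at tK, the replacement of T(ty)/T(t) by y^{-β} on [0, K], and the cut of the limiting integral.
All are bounded independently of σ, since |σ e^{-σy}| ≤ 1. -/
theorem tendsto_massTransform_div (hβ0 : 0 < β) (hβ1 : β < 1) (hq0 : ∀ n, 0 ≤ q n)
    (hq : Summable q) (hℓ : IsSlowlyVarying ℓ)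
    (hT : Tendsto (fun x => massTail q x / (ℓ x * x ^ (-β))) atTop (𝓝 1)) :
    Tendsto (fun s : ℂ => massTransform q s / (massTail q (1 / ‖s‖) : ℂ) -
      (Real.Gamma (1 - β) : ℂ) * (s / (‖s‖ : ℂ)) ^ (β : ℂ)) halfPlaneNhds (𝓝 0) := by
  have hanti := massTail_antitone hq0 hq
  have hpos := tail_pos hanti (hℓ.eventually_tail_pos hT)
  rw [Metric.tendsto_nhds]
  intro ε hε
  -- Each cut costs 2K^{-β} in the limit, the first because T(tK)/T(t) → K^{-β}.
  obtain ⟨K, hKε, hK⟩ : ∃ K : ℝ, 4 * K ^ (-β) < ε ∧ 0 < K := by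
    have h1 := (tendsto_rpow_neg_atTop hβ0).const_mul 4
    rw [mul_zero] at h1
    exact ((h1.eventually_lt_const hε).and (eventually_gt_atTop 0)).exists
  have h1 : Tendsto (fun t => 2 * (massTail q (t * K) / massTail q t) +
      (∫ y in (0 : ℝ)..K, |massTail q (t * y) / massTail q t - y ^ (-β)|) + 2 * K ^ (-β)) atTop
      (𝓝 (2 * K ^ (-β) + 0 + 2 * K ^ (-β))) :=
    (((hℓ.tendsto_tail_ratio hT hK).const_mul 2).add
      (tendsto_massTail_integral hβ0 hβ1 hq0 hq hℓ hT hK)).add_const _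
  have h2 := h1.eventually_lt_const (u := ε) (by linarith)
  filter_upwards [tendsto_one_div_norm.eventually h2, eventually_halfPlaneNhds] with s h3 hs
  obtain ⟨hs, hs0⟩ := hs
  have hn : 0 < ‖s‖ := norm_pos_iff.2 hs0
  rw [dist_zero_right]
  refine lt_of_le_of_lt ?_ h3
  set t := 1 / ‖s‖ with ht
  have ht0 : 0 < t := by positivity
  set σ : ℂ := s / (‖s‖ : ℂ) with hσ
  have hσt : σ = s * (t : ℂ) := by rw [hσ, ht]; push_cast; ring
  have hσn : ‖σ‖ = 1 := by
    rw [hσt, norm_mul, Complex.norm_real, Real.norm_of_nonneg ht0.le, ht, mul_one_div_cancel hn.ne']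
  have hσre : 0 ≤ σ.re := by
    rw [hσt, Complex.re_mul_ofReal]; positivity
  have hσ0 : σ ≠ 0 := norm_pos_iff.1 (by rw [hσn]; exact one_pos)
  have hTt := hpos t
  have hTtC : (massTail q t : ℂ) ≠ 0 := Complex.ofReal_ne_zero.2 hTt.ne'
  have hA := norm_massTransform_sub_integral_le hq0 hq hs (mul_nonneg ht0.le hK.le)
  have hscale : ∫ x in (0 : ℝ)..t * K, s * Complex.exp (-(s * x)) * (massTail q x : ℂ)
      = ∫ y in (0 : ℝ)..K, σ * Complex.exp (-(σ * y)) * (massTail q (t * y) : ℂ) := by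
    have h4 := intervalIntegral.smul_integral_comp_mul_left (a := 0) (b := K)
      (fun x : ℝ => s * Complex.exp (-(s * x)) * (massTail q x : ℂ)) t
    rw [mul_zero] at h4
    rw [← h4, ← intervalIntegral.integral_smul]
    congr 1; ext y
    rw [hσt, Complex.real_smul]
    push_cast
    ring_nf
  rw [hscale] at hA
  set I₁ := ∫ y in (0 : ℝ)..K, σ * Complex.exp (-(σ * y)) * (massTail q (t * y) : ℂ) with hI₁
  set I₂ := ∫ y in (0 : ℝ)..K, σ * Complex.exp (-(σ * y)) * ((y ^ (-β) : ℝ) : ℂ) with hI₂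
  have hmeasT : Measurable fun y : ℝ => massTail q (t * y) :=
    hanti.measurable.comp (measurable_const_mul t)
  have hmeasP : Measurable fun y : ℝ => y ^ (-β) := measurable_id.pow_const (-β)
  have hrp : IntervalIntegrable (fun y : ℝ => y ^ (-β)) volume 0 K :=
    intervalIntegral.intervalIntegrable_rpow' (by linarith)
  have hTi : IntervalIntegrable (fun y : ℝ => massTail q (t * y)) volume 0 K := by
    have : Antitone fun y : ℝ => massTail q (t * y) := fun x y hxy =>
      hanti (mul_le_mul_of_nonneg_left hxy ht0.le)
    exact this.intervalIntegrable
  have hker : ∀ {u : ℝ → ℝ}, Measurable u → IntervalIntegrable u volume 0 K →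
      IntervalIntegrable (fun y : ℝ => σ * Complex.exp (-(σ * y)) * ((u y : ℝ) : ℂ)) volume 0 K := by
    intro u hu hui
    have hui' := (intervalIntegrable_iff_integrableOn_Ioc_of_le hK.le).1 hui
    rw [intervalIntegrable_iff_integrableOn_Ioc_of_le hK.le]
    refine hui'.norm.mono' (aestronglyMeasurable_kernel σ hu _) ?_
    refine (ae_restrict_mem measurableSet_Ioc).mono fun y hy => ?_
    rw [norm_mul, Complex.norm_real]
    refine mul_le_of_le_one_left (norm_nonneg _) ?_
    rw [← hσn]
    exact norm_mul_exp_neg_mul_le hσre hy.1.le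
  have hB : ‖I₁ / (massTail q t : ℂ) - I₂‖
      ≤ ∫ y in (0 : ℝ)..K, |massTail q (t * y) / massTail q t - y ^ (-β)| := by
    rw [hI₁, hI₂, ← intervalIntegral.integral_div, ← intervalIntegral.integral_sub
      ((hker hmeasT hTi).div_const _) (hker hmeasP hrp)]
    refine intervalIntegral.norm_integral_le_of_norm_le hK.le (Eventually.of_forall fun y hy => ?_)
      ((hTi.div_const _).sub hrp).abs
    have h5 : σ * Complex.exp (-(σ * y)) * (massTail q (t * y) : ℂ) / (massTail q t : ℂ)
        - σ * Complex.exp (-(σ * y)) * ((y ^ (-β) : ℝ) : ℂ)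
        = σ * Complex.exp (-(σ * y)) *
          ((massTail q (t * y) / massTail q t - y ^ (-β) : ℝ) : ℂ) := by
      push_cast; ring
    rw [h5, norm_mul, Complex.norm_real, Real.norm_eq_abs]
    refine mul_le_of_le_one_left (abs_nonneg _) ?_
    rw [← hσn]
    exact norm_mul_exp_neg_mul_le hσre hy.1.le
  have hCb := norm_truncated_sub_le hβ0 hβ1 hσre hσ0 hK
  rw [← hI₂] at hCb
  have hA' : ‖massTransform q s / (massTail q t : ℂ) - I₁ / (massTail q t : ℂ)‖
      ≤ 2 * (massTail q (t * K) / massTail q t) := by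
    rw [← sub_div, norm_div, Complex.norm_real, Real.norm_of_nonneg hTt.le, ← mul_div_assoc]
    exact div_le_div_of_nonneg_right hA hTt.le
  calc _ = ‖(massTransform q s / (massTail q t : ℂ) - I₁ / (massTail q t : ℂ)) +
          (I₁ / (massTail q t : ℂ) - I₂) +
          (I₂ - (Real.Gamma (1 - β) : ℂ) * σ ^ (β : ℂ))‖ := by congr 1; ring
    _ ≤ _ := (norm_add₃_le).trans (add_le_add (add_le_add hA' hB) hCb)

/-- The Abelian theorem for tails of index `-β`, in the closed half plane. -/
theorem isEquivalent_massTransform (hβ0 : 0 < β) (hβ1 : β < 1) (hq0 : ∀ n, 0 ≤ q n)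
    (hq : Summable q) (hℓ : IsSlowlyVarying ℓ)
    (hT : Tendsto (fun x => massTail q x / (ℓ x * x ^ (-β))) atTop (𝓝 1)) :
    Asymptotics.IsEquivalent halfPlaneNhds (massTransform q) fun s : ℂ =>
      (Real.Gamma (1 - β) : ℂ) * (ℓ (1 / ‖s‖) : ℂ) * s ^ (β : ℂ) := by
  have hanti := massTail_antitone hq0 hq
  have hpos := tail_pos hanti (hℓ.eventually_tail_pos hT)
  have hΓ : 0 < Real.Gamma (1 - β) := Real.Gamma_pos_of_pos (by linarith)
  set P : ℂ → ℂ := fun s => (Real.Gamma (1 - β) : ℂ) * (s / (‖s‖ : ℂ)) ^ (β : ℂ) with hP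
  -- The modulus of P is constant and nonzero, so the additive o(1) is also a relative one.
  have hPn : ∀ s : ℂ, s ≠ 0 → ‖P s‖ = Real.Gamma (1 - β) := by
    intro s hs
    have h1 : ‖s / (‖s‖ : ℂ)‖ = 1 := by
      rw [norm_div, Complex.norm_real, norm_norm, div_self (norm_ne_zero_iff.2 hs)]
    simp only [hP]
    rw [norm_mul, Complex.norm_real, Real.norm_of_nonneg hΓ.le, Complex.norm_cpow_real, h1,
      Real.one_rpow, mul_one]
  have hP0 : ∀ s : ℂ, s ≠ 0 → P s ≠ 0 := fun s hs => norm_pos_iff.1 (by rw [hPn s hs]; exact hΓ)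
  rw [Asymptotics.isEquivalent_iff_tendsto_one]
  swap
  · filter_upwards [tendsto_one_div_norm.eventually hℓ.2.1, eventually_halfPlaneNhds] with s h1 h2
    refine mul_ne_zero (mul_ne_zero ?_ ?_) ?_
    · exact Complex.ofReal_ne_zero.2 hΓ.ne'
    · exact Complex.ofReal_ne_zero.2 h1.ne'
    · simp [Complex.cpow_eq_zero_iff, h2.2]
  have h1 : Tendsto (fun s : ℂ => massTransform q s / (massTail q (1 / ‖s‖) : ℂ) / P s)
      halfPlaneNhds (𝓝 1) := by
    have h2 := (tendsto_massTransform_div hβ0 hβ1 hq0 hq hℓ hT).norm.div_const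
      (Real.Gamma (1 - β))
    rw [norm_zero, zero_div] at h2
    rw [tendsto_iff_norm_sub_tendsto_zero]
    refine h2.congr' ?_
    filter_upwards [eventually_halfPlaneNhds] with s hs
    have h4 : massTransform q s / (massTail q (1 / ‖s‖) : ℂ) / P s - 1
        = (massTransform q s / (massTail q (1 / ‖s‖) : ℂ) - P s) / P s := by
      rw [sub_div, div_self (hP0 s hs.2)]
    rw [h4, norm_div, hPn s hs.2]
  have h3 : Tendsto (fun s : ℂ => ((massTail q (1 / ‖s‖) /
      (ℓ (1 / ‖s‖) * (1 / ‖s‖) ^ (-β)) : ℝ) : ℂ)) halfPlaneNhds (𝓝 1) := by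
    have := (Complex.continuous_ofReal.tendsto 1).comp (hT.comp tendsto_one_div_norm)
    rwa [Complex.ofReal_one] at this
  have h4 := h1.mul h3
  rw [one_mul] at h4
  refine h4.congr' ?_
  filter_upwards [tendsto_one_div_norm.eventually hℓ.2.1, eventually_halfPlaneNhds] with s h5 hs
  have hn : 0 < ‖s‖ := norm_pos_iff.2 hs.2
  -- The principal branch is homogeneous under positive scaling, as the logarithm then shifts by a
  -- real number.
  have h6 : s ^ (β : ℂ) = ((1 / ‖s‖) ^ (-β) : ℝ) * (s / (‖s‖ : ℂ)) ^ (β : ℂ) := by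
    have hσ : s / (‖s‖ : ℂ) ≠ 0 := div_ne_zero hs.2 (Complex.ofReal_ne_zero.2 hn.ne')
    have h7 : Complex.log s = (Real.log ‖s‖ : ℂ) + Complex.log (s / (‖s‖ : ℂ)) := by
      rw [← Complex.log_ofReal_mul hn hσ, mul_div_cancel₀ _ (Complex.ofReal_ne_zero.2 hn.ne')]
    rw [one_div, Real.inv_rpow hn.le, Real.rpow_neg hn.le, inv_inv, Real.rpow_def_of_pos hn,
      Complex.cpow_def_of_ne_zero hs.2, Complex.cpow_def_of_ne_zero hσ, h7, add_mul,
      Complex.exp_add]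
    push_cast
    rfl
  have h7 := Complex.ofReal_ne_zero.2 (hpos (1 / ‖s‖)).ne'
  have h8 := hP0 s hs.2
  have h9 : (Real.Gamma (1 - β) : ℂ) * (ℓ (1 / ‖s‖) : ℂ) * s ^ (β : ℂ)
      = ((ℓ (1 / ‖s‖) * (1 / ‖s‖) ^ (-β) : ℝ) : ℂ) * P s := by
    rw [h6, hP]; push_cast; ring
  simp only [Pi.div_apply]
  rw [h9, Complex.ofReal_div]
  field_simp

/-- From |1 - e^{-sy}| ≤ 2 min(1, |s|y), Fubini bounds the sum by 2∫₀¹ T(ty) dy with t = 1/|s|. The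
Potter bound makes this O(T(t)), and |s^β| = t^{-β}. -/
theorem isBigO_massTransform_norm (hβ0 : 0 < β) (hβ1 : β < 1) (hq0 : ∀ n, 0 ≤ q n)
    (hq : Summable q) (hℓ : IsSlowlyVarying ℓ)
    (hT : Tendsto (fun x => massTail q x / (ℓ x * x ^ (-β))) atTop (𝓝 1)) :
    (fun s : ℂ => ∑' n : ℕ, q n * ‖1 - Complex.exp (-(s * ((n + 1 : ℝ) : ℂ)))‖)
      =O[halfPlaneNhds] fun s : ℂ =>
        (Real.Gamma (1 - β) : ℂ) * (ℓ (1 / ‖s‖) : ℂ) * s ^ (β : ℂ) := by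
  have hanti := massTail_antitone hq0 hq
  have hpos := tail_pos hanti (hℓ.eventually_tail_pos hT)
  have hΓ : 0 < Real.Gamma (1 - β) := Real.Gamma_pos_of_pos (by linarith)
  set κ := (1 + β) / 2 with hκ
  obtain ⟨C, hC1, hC⟩ := hℓ.exists_tail_le hanti hT (κ := κ) (by linarith) (by linarith)
  set J := ∫ y in (0 : ℝ)..1, y ^ (-κ) with hJ
  have hJ0 : 0 ≤ J :=
    intervalIntegral.integral_nonneg zero_le_one fun y hy => Real.rpow_nonneg hy.1 _
  refine Asymptotics.IsBigO.of_bound (2 * (C * J) * 2 / Real.Gamma (1 - β)) ?_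
  filter_upwards [tendsto_one_div_norm.eventually hC, tendsto_one_div_norm.eventually hℓ.2.1,
    tendsto_one_div_norm.eventually (hT.eventually_lt_const one_lt_two),
    eventually_halfPlaneNhds] with s h1 h2 h3 hs
  obtain ⟨hs, hs0⟩ := hs
  have hn : 0 < ‖s‖ := norm_pos_iff.2 hs0
  have htarget : ‖(Real.Gamma (1 - β) : ℂ) * (ℓ (1 / ‖s‖) : ℂ) * s ^ (β : ℂ)‖
      = Real.Gamma (1 - β) * (ℓ (1 / ‖s‖) * (1 / ‖s‖) ^ (-β)) := by
    rw [norm_mul, norm_mul, Complex.norm_real, Complex.norm_real, Real.norm_of_nonneg hΓ.le,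
      Real.norm_of_nonneg h2.le, Complex.norm_cpow_real, one_div, Real.inv_rpow hn.le,
      Real.rpow_neg hn.le, inv_inv, mul_assoc]
  rw [htarget]
  set t := 1 / ‖s‖ with ht
  have ht0 : 0 < t := by positivity
  have hst : ‖s‖ = t⁻¹ := by rw [ht, one_div, inv_inv]
  have hℓt : 0 < ℓ t * t ^ (-β) := mul_pos h2 (Real.rpow_pos_of_pos ht0 _)
  rw [div_lt_iff₀ hℓt] at h3
  have hsum : HasSum (fun n : ℕ => q n * min ((n : ℝ) + 1) t) (∫ x in (0 : ℝ)..t, massTail q x) := by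
    have h4 := hasSum_integral_mul_massTail hq0 hq (k := fun _ => 1) continuous_const ht0.le
    simp only [intervalIntegral.integral_const, sub_zero, Complex.real_smul, mul_one, one_mul,
      intervalIntegral.integral_ofReal, ← Complex.ofReal_mul, Complex.hasSum_ofReal] at h4
    exact h4
  have hscale : t⁻¹ * ∫ x in (0 : ℝ)..t, massTail q x = ∫ y in (0 : ℝ)..1, massTail q (t * y) := by
    have := intervalIntegral.smul_integral_comp_mul_left (a := 0) (b := 1) (massTail q) t
    rw [mul_zero, mul_one, smul_eq_mul] at this
    rw [← this, inv_mul_cancel_left₀ ht0.ne']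
  have hint : ∫ y in (0 : ℝ)..1, massTail q (t * y) ≤ C * J * massTail q t := by
    have hr : IntervalIntegrable (fun y : ℝ => y ^ (-κ)) volume 0 1 :=
      intervalIntegral.intervalIntegrable_rpow' (by linarith)
    have ha : Antitone fun y : ℝ => massTail q (t * y) := fun x y hxy =>
      hanti (mul_le_mul_of_nonneg_left hxy ht0.le)
    rw [hJ, ← intervalIntegral.integral_const_mul, ← intervalIntegral.integral_mul_const]
    exact intervalIntegral.integral_mono_on_of_le_Ioo zero_le_one ha.intervalIntegrable
      ((hr.const_mul C).mul_const _) fun y hy => h1 y ⟨hy.1, hy.2.le⟩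
  rw [Real.norm_of_nonneg (tsum_nonneg fun n => mul_nonneg (hq0 n) (norm_nonneg _))]
  have hle : ∑' n : ℕ, q n * ‖1 - Complex.exp (-(s * ((n + 1 : ℝ) : ℂ)))‖
      ≤ 2 * (t⁻¹ * ∫ x in (0 : ℝ)..t, massTail q x) := by
    refine (summable_massTransform hq0 hq hs).tsum_le_of_sum_le fun S => ?_
    have h5 := (hsum.mul_left t⁻¹).mul_left 2
    refine (Finset.sum_le_sum fun n _ => ?_).trans
      (sum_le_hasSum S (fun n _ => ?_) h5)
    · have h6 := norm_one_sub_exp_le hs (y := (n : ℝ) + 1) (by positivity)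
      have h7 : min 1 (‖s‖ * ((n : ℝ) + 1)) = t⁻¹ * min ((n : ℝ) + 1) t := by
        rw [hst, mul_min_of_nonneg _ _ (inv_pos.2 ht0).le, inv_mul_cancel₀ ht0.ne', min_comm]
      rw [h7] at h6
      calc _ ≤ q n * (2 * (t⁻¹ * min ((n : ℝ) + 1) t)) := mul_le_mul_of_nonneg_left h6 (hq0 n)
        _ = _ := by ring
    · have := hq0 n
      have : 0 ≤ min ((n : ℝ) + 1) t := le_min (by positivity) ht0.le
      positivity
  refine hle.trans ?_
  rw [hscale]
  have hCJ : 0 ≤ C * J := by positivity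
  calc 2 * ∫ y in (0 : ℝ)..1, massTail q (t * y) ≤ 2 * (C * J * (2 * (ℓ t * t ^ (-β)))) := by
        have := mul_le_mul_of_nonneg_left h3.le hCJ
        linarith
    _ = _ := by field_simp

end Abelian

/-! ### Return levels and the tail of the return time -/

section ReturnLevels

variable {M : Type*} {f : M → M} {Y : Set M}

theorem returnTime_eq_succ_iff (f : M → M) (Y : Set M) (x : M) (n : ℕ) :
    returnTime f Y x = n + 1 ↔ f^[n + 1] x ∈ Y ∧ ∀ k < n, f^[k + 1] x ∉ Y := by
  unfold returnTime
  constructor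
  · intro h
    have hne : {n | 1 ≤ n ∧ f^[n] x ∈ Y}.Nonempty :=
      Nat.nonempty_of_pos_sInf (by rw [h]; exact Nat.succ_pos n)
    have hmem := Nat.sInf_mem hne
    rw [h] at hmem
    refine ⟨hmem.2, fun k hk hkY => ?_⟩
    have := Nat.sInf_le (s := {n | 1 ≤ n ∧ f^[n] x ∈ Y}) (m := k + 1) ⟨Nat.le_add_left 1 k, hkY⟩
    omega
  · rintro ⟨h1, h2⟩
    refine le_antisymm (Nat.sInf_le ⟨Nat.le_add_left 1 n, h1⟩) (le_csInf ⟨n + 1,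
      Nat.le_add_left 1 n, h1⟩ ?_)
    rintro j ⟨hj1, hj2⟩
    by_contra hlt
    obtain ⟨k, rfl⟩ : ∃ k, j = k + 1 := ⟨j - 1, by omega⟩
    exact h2 k (by omega) hj2

variable [MeasurableSpace M]

theorem measurableSet_returnLevel_succ (hf : Measurable f) (hY : MeasurableSet Y) (n : ℕ) :
    MeasurableSet (returnLevel f Y (n + 1)) := by
  have h : returnLevel f Y (n + 1)
      = Y ∩ (f^[n + 1] ⁻¹' Y ∩ ⋂ k ∈ Iio n, (f^[k + 1] ⁻¹' Y)ᶜ) := by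
    ext x
    simp only [returnLevel, mem_ofPred_eq, returnTime_eq_succ_iff, mem_inter_iff, mem_preimage,
      mem_iInter, mem_compl_iff, mem_Iio]
  rw [h]
  exact hY.inter ((hf.iterate _ hY).inter (MeasurableSet.biInter (to_countable _)
    fun k _ => (hf.iterate _ hY).compl))

theorem hasSum_returnLevel_tail (μ : Measure M) [IsFiniteMeasure μ] (hf : Measurable f)
    (hY : MeasurableSet Y) (n : ℕ) :
    HasSum (fun k : ℕ => if (n : ℝ) < k + 1 then μ.real (returnLevel f Y (k + 1)) else 0)
      (μ.real {y ∈ Y | n < returnTime f Y y}) := by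
  -- Index k stands for return time k + 1, so points that never return, whose return time is 0 by
  -- convention, are not counted.
  set A : ℕ → Set M := fun k => if (n : ℝ) < k + 1 then returnLevel f Y (k + 1) else ∅ with hA
  have hlt : ∀ k : ℕ, (n : ℝ) < k + 1 ↔ n < k + 1 := fun k => by exact_mod_cast Iff.rfl
  have hmem : ∀ k x, x ∈ A k ↔ n < k + 1 ∧ x ∈ Y ∧ returnTime f Y x = k + 1 := by
    intro k x
    simp only [hA, hlt]
    split_ifs with h <;> simp only [h, true_and, false_and, mem_empty_iff_false]
    rfl
  have hU : {y ∈ Y | n < returnTime f Y y} = ⋃ k, A k := by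
    ext x
    simp only [mem_ofPred_eq, mem_iUnion, hmem]
    constructor
    · rintro ⟨h1, h2⟩
      exact ⟨returnTime f Y x - 1, by omega, h1, by omega⟩
    · rintro ⟨k, h1, h2, h3⟩
      exact ⟨h2, by omega⟩
  have hAm : ∀ k, MeasurableSet (A k) := fun k => by
    simp only [hA]
    split_ifs
    · exact measurableSet_returnLevel_succ hf hY k
    · exact MeasurableSet.empty
  have hd : Pairwise (Function.onFun Disjoint A) := by
    intro i j hij
    refine Set.disjoint_left.2 fun x hi hj => hij ?_
    have h1 := ((hmem i x).1 hi).2.2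
    have h2 := ((hmem j x).1 hj).2.2
    omega
  have hval : ∀ k, μ.real (A k)
      = if (n : ℝ) < k + 1 then μ.real (returnLevel f Y (k + 1)) else 0 := fun k => by
    simp only [hA]
    split_ifs <;> simp
  rw [hU, ← funext hval, measureReal_def, measure_iUnion hd hAm]
  have hfin : ∑' k, μ (A k) ≠ ⊤ := by
    rw [← measure_iUnion hd hAm]; exact measure_ne_top μ _
  rw [ENNReal.tsum_toReal_eq (fun k => measure_ne_top μ _)]
  exact (ENNReal.summable_toReal hfin).hasSum

end ReturnLevels

theorem IsTransferOf.integral_eq {M : Type*} [MeasurableSpace M] {ν : Measure M} {F : M → M}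
    {g g' : M → ℂ} (h : IsTransferOf ν F g g') : ∫ x, g' x ∂ν = ∫ x, g x ∂ν := by
  simpa using h.2 (fun _ => 1) measurable_const ⟨1, fun _ => by simp⟩

/-! ### Duality identities on the closed span of the integrable functions -/

namespace DistributionSpaces

variable {E : Type*} [NormedAddCommGroup E] [NormedSpace ℝ E] {H : Type*} [TopologicalSpace H]
  {I : ModelWithCorners ℝ E H} {M : Type*} [TopologicalSpace M] [ChartedSpace H M]
  [MeasurableSpace M] {ι : Type*} {c : ChartCover I M ι} {α γ : ℝ} {m : Measure M} {Y : Set M}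
  {B Bw : Type*} [NormedAddCommGroup B] [NormedSpace ℂ B] [NormedAddCommGroup Bw]
  [NormedSpace ℂ Bw]

/-- The functional `h ↦ ⟨h, 1⟩` on `B`. -/
def mass (S : DistributionSpaces c α γ m Y B Bw) : B →L[ℂ] ℂ :=
  (ContinuousLinearMap.apply ℂ ℂ (1 : HolderSpace c γ)).comp (S.toDual.comp S.toWeak)

theorem mass_apply (S : DistributionSpaces c α γ m Y B Bw) (h : B) :
    S.mass h = S.toDual (S.toWeak h) 1 := rfl

theorem Represents.apply_one {S : DistributionSpaces c α γ m Y B Bw} {ν : Measure M} {g : M → ℂ}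
    {h : Bw} (hr : S.Represents ν g h) : S.toDual h 1 = ∫ x, g x ∂ν := by
  rw [hr.2]
  refine integral_congr_ae (Eventually.of_forall fun x => ?_)
  change g x * 1 = g x
  rw [mul_one]

/-- The set `B ∩ L¹(Y, m)`. -/
def functions (S : DistributionSpaces c α γ m Y B Bw) : Set B :=
  {h | ∃ g : M → ℂ, S.Represents (m.restrict Y) g (S.toWeak h)}

/-- The closed linear span of `B ∩ L¹(Y, m)`. -/
def closedFunctions (S : DistributionSpaces c α γ m Y B Bw) : Submodule ℂ B :=
  (Submodule.span ℂ S.functions).topologicalClosure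

variable {S : DistributionSpaces c α γ m Y B Bw}

theorem isClosed_closedFunctions : IsClosed (S.closedFunctions : Set B) :=
  Submodule.isClosed_topologicalClosure _

theorem functions_subset_closedFunctions : S.functions ⊆ S.closedFunctions :=
  Submodule.subset_span.trans (Submodule.le_topologicalClosure _)

theorem eqOn_closedFunctions {a b : B →L[ℂ] ℂ} (h : EqOn a b S.functions) :
    EqOn a b S.closedFunctions :=
  ContinuousLinearMap.eqOn_closure_span h

theorem ExtendsTransfer.mem_functions {f : M → M} {A : Set M} {T : B →L[ℂ] B}
    (hT : S.ExtendsTransfer f A T) {h : B} (hh : h ∈ S.functions) : T h ∈ S.functions := by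
  obtain ⟨g, hg⟩ := hh
  obtain ⟨g', -, hg'⟩ := hT h g hg
  exact ⟨g', hg'⟩

theorem ExtendsTransfer.mem_closedFunctions {f : M → M} {A : Set M} {T : B →L[ℂ] B}
    (hT : S.ExtendsTransfer f A T) {h : B} (hh : h ∈ S.closedFunctions) :
    T h ∈ S.closedFunctions := by
  have h1 : S.closedFunctions ≤ S.closedFunctions.comap (T : B →ₗ[ℂ] B) :=
    Submodule.topologicalClosure_minimal _
      (Submodule.span_le.2 fun x hx => functions_subset_closedFunctions (hT.mem_functions hx))
      (isClosed_closedFunctions.preimage T.continuous)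
  exact h1 hh

theorem ExtendsTransfer.mass_eq {f : M → M} {A : Set M} {T : B →L[ℂ] B}
    (hT : S.ExtendsTransfer f A T) (hA : MeasurableSet A) {h : B} {g : M → ℂ}
    (hg : S.Represents (m.restrict Y) g (S.toWeak h)) :
    S.mass (T h) = ∫ x in A, g x ∂(m.restrict Y) := by
  obtain ⟨g', hg1, hg2⟩ := hT h g hg
  rw [mass_apply, hg2.apply_one, hg1.integral_eq, integral_indicator hA]

/-- `R` preserves the mass of the limits of functions. -/
theorem ExtendsTransfer.mass_univ {f : M → M} {R : B →L[ℂ] B}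
    (hR : S.ExtendsTransfer f univ R) {h : B} (hh : h ∈ S.closedFunctions) :
    S.mass (R h) = S.mass h := by
  refine eqOn_closedFunctions (a := S.mass.comp R) (b := S.mass) ?_ hh
  rintro x ⟨g, hg⟩
  rw [ContinuousLinearMap.comp_apply, hR.mass_eq MeasurableSet.univ hg, mass_apply, hg.apply_one,
    Measure.restrict_univ]

/-- On limits of functions, `⟨R (1_A h), 1⟩ = ⟨1_A h, 1⟩`. -/
theorem ExtendsTransfer.mass_eq_indicatorMul [IsFiniteMeasure (m.restrict Y)] {f : M → M}
    {A : Set M} {T : B →L[ℂ] B} (hT : S.ExtendsTransfer f A T) (hA : MeasurableSet A)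
    {J : B →ₗ[ℂ] Bw} (hJ : S.IsIndicatorMul A J) {K : ℝ} (hK : ∀ h, ‖S.toDual (J h) 1‖ ≤ K * ‖h‖)
    {h : B} (hh : h ∈ S.closedFunctions) : S.mass (T h) = S.toDual (J h) 1 := by
  -- J is merely linear, but `hK` makes h ↦ ⟨J h, 1⟩ continuous, so an equality checked on functions
  -- passes to their closed span.
  let a : B →ₗ[ℂ] ℂ := ((ContinuousLinearMap.apply ℂ ℂ (1 : HolderSpace c γ)).comp
    S.toDual).toLinearMap.comp J
  refine eqOn_closedFunctions (a := S.mass.comp T) (b := a.mkContinuous K hK) ?_ hh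
  rintro x ⟨g, hg⟩
  rw [ContinuousLinearMap.comp_apply, hT.mass_eq hA hg]
  exact (hJ x (m.restrict Y) g hg).apply_one.symm

theorem represents_incl_one (hmY : m Y = 1) :
    S.Represents (m.restrict Y) (fun _ => 1) (S.toWeak (S.incl 1)) := by
  have : IsFiniteMeasure (m.restrict Y) := ⟨by rw [Measure.restrict_apply_univ, hmY]; simp⟩
  exact ⟨integrable_const 1, fun φ => S.toDual_incl 1 φ⟩

/-- The invariant density is a limit of functions. -/
theorem mem_closedFunctions_of_fixed [CompleteSpace B] (hmY : m Y = 1) {f : M → M}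
    {R : B →L[ℂ] B} (hR : S.ExtendsTransfer f univ R) (hgap : IsLeadingEigenvalue R 1) {h : B}
    (hh : R h = h) (hmass : S.mass h = 1) : h ∈ S.closedFunctions := by
  have hne : h ≠ 0 := by
    rintro rfl
    simp at hmass
  -- The iterates of the constant 1 are functions of mass 1. By the spectral gap they converge to a
  -- multiple of h, and continuity of the mass forces the multiple to be h itself.
  have hmem : ∀ n : ℕ, (R ^ n) (S.incl 1) ∈ S.functions := by
    intro n
    induction n with
    | zero => exact ⟨_, represents_incl_one hmY⟩
    | succ n ih => rw [pow_succ']; exact hR.mem_functions ih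
  have hm1 : ∀ n : ℕ, S.mass ((R ^ n) (S.incl 1)) = 1 := by
    intro n
    induction n with
    | zero =>
      have := (represents_incl_one (S := S) hmY).apply_one
      simpa [mass_apply, measureReal_def, hmY] using this
    | succ n ih =>
      rw [pow_succ', mul_apply_eq_comp,
        hR.mass_univ (functions_subset_closedFunctions (hmem n)), ih]
  obtain ⟨a, ha⟩ := hgap.tendsto_pow hh hne (S.incl 1)
  have h1 := (S.mass.continuous.tendsto _).comp ha
  simp only [Function.comp_def, hm1, map_smul, hmass, smul_eq_mul, mul_one] at h1
  have h2 : a = 1 := tendsto_nhds_unique h1 tendsto_const_nhds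
  rw [h2, one_smul] at ha
  exact isClosed_closedFunctions.mem_of_tendsto ha
    (Eventually.of_forall fun n => functions_subset_closedFunctions (hmem n))

end DistributionSpaces

/-! ### The operators R(z) and their pairing with 1 -/

section PerturbedOperator

variable {B : Type*} [NormedAddCommGroup B] [NormedSpace ℂ B] [CompleteSpace B]
  {Rn : ℕ → B →L[ℂ] B}

omit [CompleteSpace B] in
theorem norm_pow_smul_le {z : ℂ} (hz : ‖z‖ ≤ 1) (n : ℕ) :
    ‖z ^ (n + 1) • Rn (n + 1)‖ ≤ ‖Rn (n + 1)‖ := by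
  rw [norm_smul, norm_pow]
  exact mul_le_of_le_one_left (norm_nonneg _) (pow_le_one₀ (norm_nonneg _) hz)

theorem hasSum_perturbedOperator (hsum : Summable fun n : ℕ => ‖Rn (n + 1)‖) {z : ℂ}
    (hz : ‖z‖ ≤ 1) :
    HasSum (fun n : ℕ => z ^ (n + 1) • Rn (n + 1)) (perturbedOperator Rn z) :=
  (hsum.of_norm_bounded (norm_pow_smul_le hz)).hasSum

theorem continuousOn_perturbedOperator (hsum : Summable fun n : ℕ => ‖Rn (n + 1)‖) :
    ContinuousOn (perturbedOperator Rn) {z | ‖z‖ ≤ 1} :=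
  continuousOn_tsum (fun n => by fun_prop) hsum fun n _ hz => norm_pow_smul_le hz n

theorem perturbedOperator_mem (hsum : Summable fun n : ℕ => ‖Rn (n + 1)‖) {V : Submodule ℂ B}
    (hV : IsClosed (V : Set B)) (hRV : ∀ n, ∀ h ∈ V, Rn (n + 1) h ∈ V) {z : ℂ} (hz : ‖z‖ ≤ 1)
    {h : B} (hh : h ∈ V) : perturbedOperator Rn z h ∈ V := by
  have h1 := (hasSum_perturbedOperator hsum hz).mapL (ContinuousLinearMap.apply ℂ B h)
  exact hV.mem_of_tendsto h1 (Eventually.of_forall fun s => V.sum_mem fun n _ =>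
    V.smul_mem _ (hRV n h hh))

/-- If `|a (R_{n+1} h)| ≤ K q_n ‖h‖` on `V` and `a (R_{n+1} h₀) = q_n`, then
`a ((R(1) - R(z)) v)` is close to `∑ q_n (1 - z^{n+1})` for `v` close to `h₀`. -/
theorem norm_apply_sub_massTransform_le (hsum : Summable fun n : ℕ => ‖Rn (n + 1)‖)
    {V : Submodule ℂ B} {a : B →L[ℂ] ℂ} {q : ℕ → ℝ} (hq0 : ∀ n, 0 ≤ q n) (hq : Summable q) {K : ℝ}
    (hbound : ∀ n, ∀ h ∈ V, ‖a (Rn (n + 1) h)‖ ≤ K * ‖h‖ * q n) {h0 v : B} (h0V : h0 ∈ V)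
    (hv : v ∈ V) (hval : ∀ n, a (Rn (n + 1) h0) = q n) {s : ℂ} (hs : 0 ≤ s.re) :
    ‖a (perturbedOperator Rn 1 v) - a (perturbedOperator Rn (Complex.exp (-s)) v)
      - massTransform q s‖ ≤ K * ‖v - h0‖ *
        ∑' n : ℕ, q n * ‖1 - Complex.exp (-(s * ((n + 1 : ℝ) : ℂ)))‖ := by
  have hz : ‖Complex.exp (-s)‖ ≤ 1 := by
    have := norm_exp_neg_mul_le_one hs zero_le_one
    simpa using this
  have hexp : ∀ n : ℕ, Complex.exp (-s) ^ (n + 1) = Complex.exp (-(s * ((n + 1 : ℝ) : ℂ))) := by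
    intro n
    rw [← Complex.exp_nat_mul]
    congr 1; push_cast; ring
  have hA : ∀ z : ℂ, ‖z‖ ≤ 1 → HasSum (fun n : ℕ => z ^ (n + 1) * a (Rn (n + 1) v))
      (a (perturbedOperator Rn z v)) := by
    intro z hz
    have h1 := (hasSum_perturbedOperator hsum hz).mapL
      (a.comp (ContinuousLinearMap.apply ℂ B v))
    simpa using h1
  have h1 := hA 1 (by simp)
  have h2 := hA _ hz
  have h3 : HasSum (fun n : ℕ => (q n : ℂ) * (1 - Complex.exp (-(s * ((n + 1 : ℝ) : ℂ)))))
      (massTransform q s) := by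
    refine (Summable.of_norm ?_).hasSum
    refine (summable_massTransform hq0 hq hs).congr fun n => ?_
    rw [norm_mul, Complex.norm_real, Real.norm_of_nonneg (hq0 n)]
  rw [← ((h1.sub h2).sub h3).tsum_eq]
  refine tsum_of_norm_bounded ((summable_massTransform hq0 hq hs).hasSum.mul_left _) fun n => ?_
  -- The h₀ part cancels exactly against q_n, so only v - h₀ meets the bound on V.
  have h4 : (1 : ℂ) ^ (n + 1) * a (Rn (n + 1) v) - Complex.exp (-s) ^ (n + 1) * a (Rn (n + 1) v)
      - (q n : ℂ) * (1 - Complex.exp (-(s * ((n + 1 : ℝ) : ℂ))))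
      = a (Rn (n + 1) (v - h0)) * (1 - Complex.exp (-(s * ((n + 1 : ℝ) : ℂ)))) := by
    rw [hexp, map_sub, map_sub, hval]; ring
  rw [h4, norm_mul]
  refine (mul_le_mul_of_nonneg_right (hbound n _ (V.sub_mem hv h0V)) (norm_nonneg _)).trans
    (le_of_eq ?_)
  ring

end PerturbedOperator

end

/-! ### Asymptotics of the leading eigenvalue -/

theorem lemma3p1
    {E : Type*} [NormedAddCommGroup E] [NormedSpace ℝ E] [FiniteDimensional ℝ E]
    {H : Type*} [TopologicalSpace H] {I : ModelWithCorners ℝ E H}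
    {M : Type*} [TopologicalSpace M] [ChartedSpace H M] [IsManifold I ∞ M] [T2Space M]
    [SecondCountableTopology M] [MeasurableSpace M] [BorelSpace M]
    {ι : Type*} (c : ChartCover I M ι)
    -- the dynamical system and its first return map
    (m : Measure M) (f : M → M) (Y : Set M)
    (hf : Measure.QuasiMeasurePreserving f m m) (hY : MeasurableSet Y) (hmY : m Y = 1)
    (hret : ∀ᵐ x ∂(m.restrict Y), ∃ n : ℕ, 1 ≤ n ∧ f^[n] x ∈ Y)
    -- the Banach spaces and the transfer operator
    {B Bw : Type*} [NormedAddCommGroup B] [NormedSpace ℂ B] [CompleteSpace B]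
    [NormedAddCommGroup Bw] [NormedSpace ℂ Bw] [CompleteSpace Bw]
    (α γ : ℝ) (hα : 0 < α) (hγ : 0 < γ) (S : DistributionSpaces c α γ m Y B Bw)
    (hmul : S.HolderMultipliers)
    (R : B →L[ℂ] B) (hR : S.ExtendsTransfer f univ R) (hgap : IsLeadingEigenvalue R 1)
    -- the operators `R_n`, with `R(1) = R`
    (Rn : ℕ → B →L[ℂ] B)
    (hRn : ∀ n : ℕ, 1 ≤ n → S.ExtendsTransfer f (returnLevel f Y n) (Rn n))
    (hsum : Summable fun n : ℕ => ‖Rn (n + 1)‖) (hR1 : perturbedOperator Rn 1 = R)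
    -- the invariant probability measure
    (μ : Measure M) [IsProbabilityMeasure μ]
    (hμ : ∃ h : B, R h = h ∧ S.Represents μ (fun _ => 1) (S.toWeak h))
    -- bounds on the distributions `1_{Y_n} h`, regularly varying tails, Lasota–Yorke inequalities
    (hlevel : S.ReturnLevelBound f μ)
    (ℓ : ℝ → ℝ) (hℓ : IsSlowlyVarying ℓ) (β : ℝ) (hβ0 : 0 < β) (hβ1 : β < 1)
    (htail : ∀ n : ℕ, 1 ≤ n →
      μ.real {y ∈ Y | n < returnTime f Y y} = ℓ n * (n : ℝ) ^ (-β))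
    (hLY : S.LasotaYorke Rn) :
    ∃ δ : ℝ, 0 < δ ∧ ∃ lam : ℂ → ℂ,
      (∀ z : ℂ, ‖z‖ ≤ 1 → ‖z - 1‖ < δ →
        IsLeadingEigenvalue (perturbedOperator Rn z) (lam z)) ∧
      Asymptotics.IsEquivalent (𝓝[{p : ℝ × ℝ | 0 ≤ p.1 ∧ p ≠ 0}] 0)
        (fun p : ℝ × ℝ => 1 - lam (Complex.exp (-((p.1 : ℂ) - Complex.I * (p.2 : ℂ)))))
        (fun p : ℝ × ℝ => (Real.Gamma (1 - β) : ℂ) *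
          (ℓ (1 / ‖(p.1 : ℂ) - Complex.I * (p.2 : ℂ)‖) : ℂ) *
          ((p.1 : ℂ) - Complex.I * (p.2 : ℂ)) ^ (β : ℂ)) := by
  obtain ⟨h0, hRh0, hrep⟩ := hμ
  have hfin : IsFiniteMeasure (m.restrict Y) :=
    ⟨by rw [Measure.restrict_apply_univ, hmY]; exact ENNReal.one_lt_top⟩
  have hmass0 : S.mass h0 = 1 := by
    rw [S.mass_apply, hrep.apply_one]
    simp
  have hne : h0 ≠ 0 := by
    rintro rfl
    simp at hmass0
  set V := S.closedFunctions with hVdef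
  have hV : IsClosed (V : Set B) := DistributionSpaces.isClosed_closedFunctions
  have h0V : h0 ∈ V := DistributionSpaces.mem_closedFunctions_of_fixed hmY hR hgap hRh0 hmass0
  -- the masses of the return levels
  set q : ℕ → ℝ := fun n => μ.real (returnLevel f Y (n + 1)) with hqdef
  have hq0 : ∀ n, 0 ≤ q n := fun n => measureReal_nonneg
  have htailsum := hasSum_returnLevel_tail μ hf.measurable hY
  have hq : Summable q := by
    refine (htailsum 0).summable.congr fun n => ?_
    rw [if_pos (by push_cast; positivity)]
  have hTn : ∀ n : ℕ, 1 ≤ n → massTail q n = ℓ n * (n : ℝ) ^ (-β) := fun n hn => by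
    rw [← htail n hn]; exact (htailsum n).tsum_eq
  have hT := hℓ.tendsto_tail_div (fun x hx => massTail_eq_floor q hx) hTn
  obtain ⟨C, hC0, hC⟩ := hlevel
  have hRV : ∀ n, ∀ h ∈ V, Rn (n + 1) h ∈ V := fun n h hh =>
    (hRn (n + 1) (Nat.le_add_left 1 n)).mem_closedFunctions hh
  have hlev : ∀ n, (∀ h ∈ V, ‖S.mass (Rn (n + 1) h)‖ ≤ C * ‖h‖ * q n) ∧
      S.mass (Rn (n + 1) h0) = q n := by
    intro n
    obtain ⟨J, hJ, hJb⟩ := hC (n + 1) (Nat.le_add_left 1 n)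
    have heq : ∀ h ∈ V, S.mass (Rn (n + 1) h) = S.toDual (J h) 1 := fun h hh =>
      (hRn (n + 1) (Nat.le_add_left 1 n)).mass_eq_indicatorMul
        (measurableSet_returnLevel_succ hf.measurable hY n) hJ (K := C * q n)
        (fun h => (hJb h).trans_eq (by rw [mul_right_comm])) hh
    -- Membership of h₀ in V gives the duality identity; its representation by μ then evaluates the
    -- indicator product as μ(Y_n). Both descriptions refer to the same J.
    refine ⟨fun h hh => by rw [heq h hh]; exact hJb h, ?_⟩
    rw [heq h0 h0V, (hJ h0 μ _ hrep).apply_one]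
    simp [hqdef]
  -- perturbation of the leading eigenvalue
  obtain ⟨η, hη, K, hpert⟩ := hgap.exists_perturbation hRh0 hne
  have hcont : Tendsto (fun z => ‖perturbedOperator Rn z - R‖) (𝓝[{z : ℂ | ‖z‖ ≤ 1}] 1) (𝓝 0) := by
    rw [← tendsto_iff_norm_sub_tendsto_zero, ← hR1]
    exact continuousOn_perturbedOperator hsum 1 (by simp)
  obtain ⟨δ, hδ, hball⟩ := Metric.mem_nhdsWithin_iff.1 (hcont.eventually_lt_const hη)
  have hnear : ∀ z : ℂ, ‖z‖ ≤ 1 ∧ ‖z - 1‖ < δ → ‖perturbedOperator Rn z - R‖ < η := fun z hz =>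
    hball ⟨mem_ball_iff_norm.2 hz.2, hz.1⟩
  have hex : ∀ z : ℂ, ∃ lam : ℂ, ∃ v : B, ‖z‖ ≤ 1 ∧ ‖z - 1‖ < δ →
      IsLeadingEigenvalue (perturbedOperator Rn z) lam ∧ perturbedOperator Rn z v = lam • v ∧
        ‖v - h0‖ ≤ K * ‖perturbedOperator Rn z - R‖ ∧ v ∈ V := by
    intro z
    by_cases hz : ‖z‖ ≤ 1 ∧ ‖z - 1‖ < δ
    · obtain ⟨lam, v, h1, h2, h3, h4⟩ := hpert _ (hnear z hz)
      exact ⟨lam, v, fun _ => ⟨h1, h2, h3, h4 V hV h0V fun x hx =>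
        perturbedOperator_mem hsum hV hRV hz.1 hx⟩⟩
    -- Arbitrary values away from 1, where nothing is claimed.
    · exact ⟨0, 0, fun h => absurd h hz⟩
  choose lam v hlam using hex
  refine ⟨δ, hδ, lam, fun z hz1 hz2 => (hlam z ⟨hz1, hz2⟩).1, ?_⟩
  set target : ℂ → ℂ := fun s =>
    (Real.Gamma (1 - β) : ℂ) * (ℓ (1 / ‖s‖) : ℂ) * s ^ (β : ℂ) with htarget
  have hzlim : Tendsto (fun s : ℂ => Complex.exp (-s)) halfPlaneNhds
      (𝓝[{z : ℂ | ‖z‖ ≤ 1}] 1) := by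
    refine tendsto_nhdsWithin_iff.2 ⟨?_, ?_⟩
    · have : Tendsto (fun s : ℂ => Complex.exp (-s)) (𝓝 0) (𝓝 (Complex.exp (-0))) :=
        (Complex.continuous_exp.comp continuous_neg).tendsto 0
      rw [neg_zero, Complex.exp_zero] at this
      exact this.mono_left nhdsWithin_le_nhds
    · filter_upwards [eventually_halfPlaneNhds] with s hs
      have := norm_exp_neg_mul_le_one hs.1 zero_le_one
      simpa using this
  have hgood : ∀ᶠ s in halfPlaneNhds, 0 ≤ s.re ∧ ‖Complex.exp (-s)‖ ≤ 1 ∧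
      ‖Complex.exp (-s) - 1‖ < δ := by
    filter_upwards [eventually_halfPlaneNhds, (tendsto_nhdsWithin_iff.1 hzlim).2,
      (tendsto_nhdsWithin_iff.1 hzlim).1.eventually (Metric.ball_mem_nhds 1 hδ)] with s h1 h2 h3
    exact ⟨h1.1, h2, mem_ball_iff_norm.1 h3⟩
  have hvlim : Tendsto (fun s => ‖v (Complex.exp (-s)) - h0‖) halfPlaneNhds (𝓝 0) := by
    have h1 := (hcont.comp hzlim).const_mul K
    rw [mul_zero] at h1
    refine squeeze_zero' (Eventually.of_forall fun s => norm_nonneg _) ?_ h1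
    filter_upwards [hgood] with s hs using (hlam _ hs.2).2.2.1
  have hElim : Tendsto (fun s => S.mass (v (Complex.exp (-s)))) halfPlaneNhds (𝓝 1) := by
    rw [← hmass0]
    exact (S.mass.continuous.tendsto h0).comp (tendsto_iff_norm_sub_tendsto_zero.2 hvlim)
  -- The mass of (R - R(z))v is (1 - λ)⟨v, 1⟩. Its distance from the generating function is C‖v -
  -- h₀‖ = o(1) times a sum that is O of the target.
  have hlittle : (fun s => (1 - lam (Complex.exp (-s))) * S.mass (v (Complex.exp (-s)))
      - massTransform q s) =o[halfPlaneNhds] target := by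
    have hbig := isBigO_massTransform_norm hβ0 hβ1 hq0 hq hℓ hT
    have h1 : (fun s => C * ‖v (Complex.exp (-s)) - h0‖ *
        ∑' n : ℕ, q n * ‖1 - Complex.exp (-(s * ((n + 1 : ℝ) : ℂ)))‖) =o[halfPlaneNhds]
        fun s => (1 : ℝ) * ‖target s‖ := by
      refine Asymptotics.IsLittleO.mul_isBigO ?_ hbig.norm_right
      rw [Asymptotics.isLittleO_one_iff]
      simpa using hvlim.const_mul C
    simp only [one_mul] at h1
    refine Asymptotics.IsBigO.trans_isLittleO ?_ h1.of_norm_right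
    refine Asymptotics.IsBigO.of_bound 1 ?_
    filter_upwards [hgood] with s hs
    obtain ⟨-, hAv, -, hvV⟩ := hlam _ hs.2
    rw [one_mul]
    refine le_trans ?_ (le_abs_self _)
    have h2 := norm_apply_sub_massTransform_le hsum hq0 hq (fun n => (hlev n).1) h0V hvV
      (fun n => (hlev n).2) hs.1
    rw [hR1, hR.mass_univ hvV, hAv, map_smul, smul_eq_mul, ← one_sub_mul] at h2
    exact h2
  have hmain : Asymptotics.IsEquivalent halfPlaneNhds
      (fun s => (1 - lam (Complex.exp (-s))) * S.mass (v (Complex.exp (-s)))) target := by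
    have h1 := (isEquivalent_massTransform hβ0 hβ1 hq0 hq hℓ hT).isLittleO.add hlittle
    refine h1.congr_left fun s => ?_
    simp only [Pi.sub_apply, htarget]
    ring
  -- As ⟨v, 1⟩ tends to 1, dividing by it leaves the asymptotics unchanged.
  have hinv : Asymptotics.IsEquivalent halfPlaneNhds
      (fun s => (S.mass (v (Complex.exp (-s))))⁻¹) (fun _ => (1 : ℂ)) := by
    refine (Asymptotics.isEquivalent_const_iff_tendsto one_ne_zero).2 ?_
    simpa using hElim.inv₀ one_ne_zero
  have hfinal : Asymptotics.IsEquivalent halfPlaneNhds (fun s => 1 - lam (Complex.exp (-s)))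
      target := by
    have h1 := hmain.mul hinv
    refine (h1.congr_left ?_).congr_right (Eventually.of_forall fun s => by simp)
    filter_upwards [hElim.eventually_ne one_ne_zero] with s hs
    simp only [Pi.mul_apply]
    exact mul_inv_cancel_right₀ hs _
  have hparam : Tendsto (fun p : ℝ × ℝ => (p.1 : ℂ) - Complex.I * (p.2 : ℂ))
      (𝓝[{p : ℝ × ℝ | 0 ≤ p.1 ∧ p ≠ 0}] 0) halfPlaneNhds := by
    refine tendsto_nhdsWithin_iff.2 ⟨?_, ?_⟩
    · have h1 : Continuous fun p : ℝ × ℝ => (p.1 : ℂ) - Complex.I * (p.2 : ℂ) := by fun_prop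
      have h2 := h1.tendsto 0
      simp only [Prod.fst_zero, Prod.snd_zero, Complex.ofReal_zero, mul_zero, sub_zero] at h2
      exact h2.mono_left nhdsWithin_le_nhds
    · filter_upwards [self_mem_nhdsWithin] with p hp
      refine ⟨by simpa using hp.1, fun h => hp.2 ?_⟩
      have hre := congrArg Complex.re h
      have him := congrArg Complex.im h
      simp at hre him
      exact Prod.ext hre him
  exact hfinal.comp_tendsto hparam
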